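/- **Setting.** A directed graph $(\mathcal V,\mathcal L)$ without self-loops, with finite node set $\mathcal V$, has integer link capacities $C_\ell$ (packets per time slot); a self-loop of infinite capacity is added at every node ("the packet stays put"). There are $J\ge 1$ packet types; type $j$ has a source $s_j$, a destination $z_j$, a deadline $d_j\in\{0,1,2,\dots\}$ and a weight $w_j\ge 0$. In each slot $t=1,\dots,T$, $a_j^t$ packets of type $j$ arrive, where the $a_j^t$ are independent over all $t$ and $j$ and $a_j^t\sim\mathrm{Binomial}(n_j,p_j)$ with $n_j\ge 1$, $p_j\in(0,1]$ (Bernoulli if $n_j=1$), of mean $\lambda_j=n_jp_j$. Put $\lambda_{\min}=\min_j\lambda_j$, $a_{\max}=\max_j n_j$, $d_{\max}=\max_j d_j$. A route-schedule of type $j$ is a walk $(k_0,\dots,k_{d_j})$ in the graph with self-loops that starts at $s_j$ and ends at $z_j$; it uses link $k_\tau$ at age $\tau$. Let $L$ be the maximum number of non-self-loop steps in a route-schedule of any type. For given arrivals, $W^\star_{\mathrm{RI}(T)}$ is the maximum total weight of packets that can be assigned to at most one route-schedule each such that, in every slot, at most $C_\ell$ packets are sent over each $\ell\in\mathcal L$.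 **Algorithm DLPF** (parameters $\epsilon\in(0,1)$ and $\zeta\ge 0$). Let $\Phi=\lceil\log_2(1/\epsilon)\rceil$, $T_0=\lfloor\epsilon(T-d_{\max}\Phi)\rfloor$ (read as $0$ if negative) and $T_\phi=2^{\phi-1}T_0$ for $\phi\ge1$. Phase $0$ lasts $T_0$ slots, and its packets are scheduled by an arbitrary algorithm. Phases $\phi=1,\dots,\Phi$ follow, phase $\phi$ lasting $d_{\max}+T_\phi$ slots (the last phases are cut off at the horizon $T$, or the last one extended to it, when rounding makes the lengths not add up to $T$). At the start of phase $\phi\geq 1$ let $\hat\lambda_j$ be the empirical average of the arrivals of type $j$ in all earlier slots, let $$\eta_\phi=\Big(1-\zeta\sqrt{\kappa\,\log(2J/\epsilon)/T_\phi}\Big)^+,\qquad \kappa=\frac{a_{\max}^2}{2\lambda_{\min}^2},$$ and let $\hat f\ge 0$ be any optimal solution (chosen as a function of the $\hat\lambda_j$ and $\eta_\phi$ only) of the linear program: maximize $\sum_j w_j\hat\lambda_j\sum_{\ell}f^0_{j\ell}$ (sum over links, including self-loops, out of $s_j$) subject to $\sum_\ell f^0_{j\ell}\le1$ (same sum); inflow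 at age $\tau-1$ equals outflow at age $\tau$ at every node for $1\le\tau\le d_j$; $f^0_{j\ell}=0$ unless $\ell$ leaves $s_j$; $f^{d_j}_{j\ell}=0$ unless $\ell$ enters $z_j$; and $\sum_j\sum_{\tau=0}^{d_j}\hat\lambda_jf^\tau_{j\ell}\le\eta_\phi C_\ell/(1+\epsilon)$ for every $\ell\in\mathcal L$. Each packet arriving in phase $\phi$ is then forwarded, until it expires, hop by hop with independent random choices: a new packet selects the link $\ell$ with probability $\hat f^0_{j\ell}$ and is dropped with the remaining probability; at age $\tau\ge1$ at node $v$ it selects an outgoing link $\ell$ with probability proportional to $\hat f^\tau_{j\ell}$. In each slot the packets are processed in an arbitrary order, and a packet is sent over its selected link if capacity is left there, else dropped. $W_{\mathrm{DLPF}}$ is the total weight of the packets delivered within their deadlines. **Theorem.** There is an absolute constant $K>0$ such that DLPF with $\zeta=1$ satisfies $$\mathbb E[W_{\mathrm{DLPF}}]\ \ge\ (1-10\epsilon)\,\mathbb E\big[W^\star_{\mathrm{RI}(T)}\big]$$ whenever $0<\epsilon<1$, $C_\ell\ge 2\left(\frac{1+\epsilon}{\epsilon}\right)^2\log\frac L\epsilon$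 for all $\ell\in\mathcal L$, and $$T\ \ge\ K\left(\frac{a_{\max}^2}{2\lambda_{\min}^2\epsilon^2}\log\frac{2J}{\epsilon}+\frac{2d_{\max}^2\log(1/\epsilon)}{\epsilon}\right).$$ The same holds, with an absolute constant $K$, for the algorithm with $\kappa=1/\lambda_{\min}$ instead, provided that $a_{\max}^2\le2\lambda_{\min}$. -/

import Mathlib

universe u v

noncomputable section

open scoped Classical

/-- A network with packet types. Time slots are numbered `0, 1, 2, …`. Links are ordered pairs of
distinct nodes. The number of type-`j` arrivals in a slot is Binomial(`trials j`, `prob j`)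
(Bernoulli when `trials j = 1`). -/
structure Network (V : Type u) where
  links : Finset (V × V)
  loopless : ∀ v, (v, v) ∉ links
  /-- capacity; only its values on `links` matter (self-loops are uncapacitated) -/
  cap : V × V → ℕ
  J : ℕ
  J_pos : 0 < J
  src : Fin J → V
  dst : Fin J → V
  deadline : Fin J → ℕ
  weight : Fin J → ℝ
  weight_nonneg : ∀ j, 0 ≤ weight j
  trials : Fin J → ℕ
  trials_pos : ∀ j, 0 < trials j
  prob : Fin J → unitInterval
  prob_pos : ∀ j, 0 < prob j

namespace Network

variable {V : Type u} (N : Network V)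

/-- The arrival rates `λ_j`. -/
def rate (j : Fin N.J) : ℝ := N.trials j * (N.prob j : ℝ)

/-- `λ_min`. -/
def rateMin : ℝ := ⨅ j, N.rate j

/-- `d_max`. -/
def dmax : ℕ := Finset.univ.sup N.deadline

/-- `a_max`: the largest possible number of arrivals of one type in one slot. -/
def amax : ℕ := Finset.univ.sup N.trials

/-- The links of the graph with all self-loops added. -/
def Ext (ℓ : V × V) : Prop := ℓ ∈ N.links ∨ ℓ.1 = ℓ.2

/-- A sequence of `d_j + 1` consecutive extended links that starts at the source of type `j`: the
links over which a packet is (attempted to be) sent at ages `0, …, d_j`. -/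
structure Walk (j : Fin N.J) where
  edge : Fin (N.deadline j + 1) → V × V
  edge_ext : ∀ τ, N.Ext (edge τ)
  start : (edge 0).1 = N.src j
  chain : ∀ τ : Fin (N.deadline j), (edge τ.castSucc).2 = (edge τ.succ).1

variable {N}

theorem Walk.edge_injective (j : Fin N.J) : Function.Injective (Walk.edge : N.Walk j → _) := by
  intro a b h
  cases a
  cases b
  cases h
  rfl

instance [Fintype V] (j : Fin N.J) : Fintype (N.Walk j) :=
  haveI : Finite (N.Walk j) := Finite.of_injective _ (Walk.edge_injective j)
  Fintype.ofFinite _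

/-- The last link of the walk leads into the destination. -/
def Walk.Arrives {j : Fin N.J} (k : N.Walk j) : Prop := (k.edge (Fin.last _)).2 = N.dst j

/-- A packet that arrives in slot `t` and follows `k` is sent over `ℓ` in slot `s`. -/
def Walk.UsesAt {j : Fin N.J} (k : N.Walk j) (t s : ℕ) (ℓ : V × V) : Prop :=
  ∃ τ : Fin (N.deadline j + 1), t + τ = s ∧ k.edge τ = ℓ

variable (N)

/-- The set `𝒦_j` of relative route-schedules. -/
abbrev Route (j : Fin N.J) : Type u := {k : N.Walk j // k.Arrives}

/-- The maximum length of a route, that is, the maximum number of transmissions over links of the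
network (not self-loops) along a route-schedule of any type. -/
def maxLen [Fintype V] : ℕ :=
  Finset.univ.sup fun j : Fin N.J => Finset.univ.sup fun k : N.Route j =>
    (Finset.univ.filter fun τ => k.1.edge τ ∈ N.links).card

/-- Arrival sequences over the horizon of `T` slots. -/
abbrev Arrivals (T : ℕ) : Type := Fin T → Fin N.J → ℕ

variable {N} {T : ℕ}

/-- The packets: `⟨(t, j), n⟩` is the `n`-th packet of type `j` arriving in slot `t`. -/
abbrev Packet (α : N.Arrivals T) : Type := Σ q : Fin T × Fin N.J, Fin (α q.1 q.2)

abbrev Packet.slot {α : N.Arrivals T} (i : Packet α) : ℕ := i.1.1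

abbrev Packet.type {α : N.Arrivals T} (i : Packet α) : Fin N.J := i.1.2

section Benchmark

variable [Fintype V]

/-- Feasibility for the integer program `RI(T)` on the arrival sequence `α`. -/
structure IsSchedule (α : N.Arrivals T) (y : (i : Packet α) → N.Route i.type → ℕ) : Prop where
  binary : ∀ i k, y i k = 0 ∨ y i k = 1
  one_choice : ∀ i, ∑ k, y i k ≤ 1
  capacity : ∀ ℓ ∈ N.links, ∀ s < T + N.dmax,
    (∑ i, ∑ k, if k.1.UsesAt i.slot s ℓ then y i k else 0) ≤ N.cap ℓ

/-- The optimal value of `RI(T)` on the arrival sequence `α`. -/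
def optRI (α : N.Arrivals T) : ℝ :=
  sSup {v | ∃ y : (i : Packet α) → N.Route i.type → ℕ,
    IsSchedule α y ∧ v = ∑ i, N.weight i.type * ∑ k, (y i k : ℝ)}

end Benchmark

section LP

variable (N) [Fintype V]

def outLinks (v : V) : Finset (V × V) := Finset.univ.filter fun ℓ => N.Ext ℓ ∧ ℓ.1 = v

def inLinks (v : V) : Finset (V × V) := Finset.univ.filter fun ℓ => N.Ext ℓ ∧ ℓ.2 = v

/-- Forwarding variables: `f j ℓ τ` for a type `j`, an extended link `ℓ` and an age `τ`. -/
abbrev Fwd : Type u := Fin N.J → V × V → ℕ → ℝ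

/-- The constraints of the program `F_S` for the rates `r`, with capacities multiplied by `η`. -/
structure LPFeasible (r : Fin N.J → ℝ) (ε η : ℝ) (f : N.Fwd) : Prop where
  nonneg : ∀ j ℓ τ, N.Ext ℓ → τ ≤ N.dmax → 0 ≤ f j ℓ τ
  one_choice : ∀ j, ∑ ℓ ∈ N.outLinks (N.src j), f j ℓ 0 ≤ 1
  conserve : ∀ j v τ, τ < N.deadline j →
    ∑ ℓ ∈ N.inLinks v, f j ℓ τ = ∑ ℓ ∈ N.outLinks v, f j ℓ (τ + 1)
  start : ∀ j ℓ, N.Ext ℓ → ℓ ∉ N.outLinks (N.src j) → f j ℓ 0 = 0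
  finish : ∀ j ℓ, N.Ext ℓ → ℓ ∉ N.inLinks (N.dst j) → f j ℓ (N.deadline j) = 0
  capacity : ∀ ℓ ∈ N.links,
    ∑ j, ∑ τ ∈ Finset.range (N.deadline j + 1), r j * f j ℓ τ ≤ η * N.cap ℓ / (1 + ε)

/-- The objective of `F_S`. -/
def lpObj (r : Fin N.J → ℝ) (f : N.Fwd) : ℝ :=
  ∑ j, N.weight j * r j * ∑ ℓ ∈ N.outLinks (N.src j), f j ℓ 0

/-- `solve r η` is an optimal solution of `F_S` for the rates `r`, with capacities multiplied by
`η`; ties between optimal solutions are broken arbitrarily. -/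
def IsLPSolver (ε : ℝ) (solve : (Fin N.J → ℝ) → ℝ → N.Fwd) : Prop :=
  ∀ (r : Fin N.J → ℝ) (η : ℝ), (∀ j, 0 ≤ r j) → 0 ≤ η →
    N.LPFeasible r ε η (solve r η) ∧
      ∀ g, N.LPFeasible r ε η g → N.lpObj r g ≤ N.lpObj r (solve r η)

variable {N}

/-- The law of the random link choices of a type-`j` packet under hop-by-hop probabilistic
forwarding: `none` means that the packet is dropped on arrival; the first link `ℓ` is chosen with
probability `f j ℓ 0`, and at age `τ ≥ 1` and node `v` the outgoing link `ℓ` of `v` is chosen with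
probability `f j ℓ τ` divided by the sum of `f j ℓ' τ` over the outgoing links `ℓ'` of `v`. -/
def walkProb (f : N.Fwd) (j : Fin N.J) : Option (N.Walk j) → ℝ
  | none => 1 - ∑ ℓ ∈ N.outLinks (N.src j), f j ℓ 0
  | some w => f j (w.edge 0) 0 * ∏ τ : Fin (N.deadline j),
      f j (w.edge τ.succ) (τ + 1) /
        ∑ ℓ ∈ N.outLinks (w.edge τ.succ).1, f j ℓ (τ + 1)

end LP

section Dynamics

/-- The links that each packet selects (those at later ages become irrelevant once the packet is
dropped); `none` for a packet that is dropped on arrival. -/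
abbrev Choice (α : N.Arrivals T) : Type u := (i : Packet α) → Option (N.Walk i.type)

/-- Packet `i` has selected link `ℓ` for slot `s`. -/
def Selects {α : N.Arrivals T} (c : Choice α) (s : ℕ) (i : Packet α) (ℓ : V × V) : Prop :=
  ∃ w, c i = some w ∧ w.UsesAt i.slot s ℓ

/-- `Alive c prio s i`: packet `i` has not been dropped for lack of capacity before slot `s`. In
slot `s` the packets are processed in increasing order of `prio s`, and a packet that has selected
link `ℓ` is forwarded if there is still capacity on `ℓ`, that is, if fewer than `cap ℓ` packets
processed before it have selected `ℓ`; else it is dropped. -/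
def Alive {α : N.Arrivals T} (c : Choice α) (prio : ℕ → Packet α → ℕ) : ℕ → Packet α → Prop
  | 0, _ => True
  | s + 1, i => Alive c prio s i ∧ ∀ ℓ ∈ N.links, Selects c s i ℓ →
      (Finset.univ.filter fun i' => Alive c prio s i' ∧ Selects c s i' ℓ ∧
        prio s i' < prio s i).card < N.cap ℓ

/-- The total weight of the packets delivered within their deadlines. -/
def reward {α : N.Arrivals T} (c : Choice α) (prio : ℕ → Packet α → ℕ) : ℝ :=
  ∑ i, if (∃ w, c i = some w ∧ w.Arrives) ∧ Alive c prio (i.slot + N.deadline i.type + 1) i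
    then N.weight i.type else 0

end Dynamics

section DLPF

variable (N) (ε : ℝ) (T : ℕ)

/-- The number `Φ` of phases after phase `0`. -/
def numPhases : ℕ := ⌈Real.logb 2 (1 / ε)⌉₊

/-- The length `T_0` of phase `0`. -/
def len0 : ℕ := ⌊ε * ((T : ℝ) - N.dmax * numPhases ε)⌋₊

/-- `T_φ = T_0 2^(φ-1)`; phase `φ ≥ 1` lasts `d_max + T_φ` slots. -/
def phaseLen (φ : ℕ) : ℕ := N.len0 ε T * 2 ^ (φ - 1)

/-- The first slot of phase `φ ≥ 1`. -/
def phaseStart (φ : ℕ) : ℕ := N.len0 ε T + ∑ i ∈ Finset.Ico 1 φ, (N.dmax + N.phaseLen ε T i)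

/-- The phase that contains slot `t`. Because of rounding, the last phase may be shorter or longer
than its nominal length: the horizon always ends after `T` slots. -/
def phaseOf (t : ℕ) : ℕ :=
  ((Finset.Icc 1 (numPhases ε)).filter fun φ => N.phaseStart ε T φ ≤ t).card

/-- The shrinkage factor of phase `φ`, for the confidence constant `κ` (truncated at `0`, since it
multiplies capacities). -/
def shrink (κ ζ : ℝ) (φ : ℕ) : ℝ :=
  max 0 (1 - ζ * √(κ * Real.log (2 * N.J / ε) / N.phaseLen ε T φ))

variable {N T}

/-- The empirical average of the arrivals in the slots before phase `φ`. -/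
def estimate (α : N.Arrivals T) (φ : ℕ) (j : Fin N.J) : ℝ :=
  (∑ t : Fin T, if (t : ℕ) < N.phaseStart ε T φ then (α t j : ℝ) else 0) / N.phaseStart ε T φ

variable [Fintype V] (κ ζ : ℝ) (solve : (Fin N.J → ℝ) → ℝ → N.Fwd)

/-- The forwarding variables used for the packets that arrive in phase `φ ≥ 1`. -/
def phaseFwd (α : N.Arrivals T) (φ : ℕ) : N.Fwd :=
  solve (estimate ε α φ) (N.shrink ε T κ ζ φ)

/-- Given the arrivals, the link choices of distinct packets are independent, and this is the law
of those of packet `i`. Packets of phase `0` draw nothing. -/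
def choiceProb (α : N.Arrivals T) (i : Packet α) (c : Option (N.Walk i.type)) : ℝ :=
  if N.phaseOf ε T i.slot = 0 then (if c = none then 1 else 0)
  else walkProb (phaseFwd ε κ ζ solve α (N.phaseOf ε T i.slot)) i.type c

/-- The packets of phase `0` are scheduled by an arbitrary algorithm `init`, the others select the
links drawn. -/
def selection (init : (α : N.Arrivals T) → Choice α → Choice α) (α : N.Arrivals T)
    (r : Choice α) : Choice α :=
  fun i => if N.phaseOf ε T i.slot = 0 then init α r i else r i

/-- The conditional expectation, given the arrival sequence `α`, of the reward that the algorithm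
DLPF collects. -/
def dlpfReward (init : (α : N.Arrivals T) → Choice α → Choice α)
    (prio : (α : N.Arrivals T) → Choice α → ℕ → Packet α → ℕ) (α : N.Arrivals T) : ℝ :=
  ∑ r : Choice α, (∏ i, choiceProb ε κ ζ solve α i (r i)) *
    reward (selection ε init α r) (prio α r)

end DLPF

end Network

/-- An algorithm whose conditional expected reward given the arrival sequence `α` is `W α` provides
a `γ`-approximation to `RI(T)` for the random arrivals `a`. -/
def ProvidesApproximation {V : Type u} [Fintype V] {N : Network V} {T : ℕ} {Ω : Type v}
    [MeasurableSpace Ω] (P : MeasureTheory.Measure Ω) (a : Fin T → Fin N.J → Ω → ℕ) (γ : ℝ)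
    (W : N.Arrivals T → ℝ) : Prop :=
  γ * ∫ ω, Network.optRI (N := N) (fun t j => a t j ω) ∂P ≤ ∫ ω, W (fun t j => a t j ω) ∂P

end

noncomputable section

open scoped Classical

/-! Both sides are compared with T·v, where v is the optimal value of the LP with the true rates and
capacities C/(1+ε).

Upper bound (`arrExp_optRI_le`). Take an optimal schedule for every arrival sequence and average how
often type j uses each link at each age. Dividing by (1+ε)(T+d_max)λ_j gives a feasible point of
that LP, so the benchmark is at most (1+ε)(T+d_max)v.

Lower bound for one slot (`arrExp_slot_ge`). Let the slot be "core": all packets that can meet a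
packet arriving in it belong to the same phase φ ≥ 1. If every estimated rate is within a factor 1±δ
of the truth, where δ is the confidence radius, then the factor 1-δ on the capacities keeps the true
expected load of each link below C/(1+ε), and the LP solution is worth at least (1-4δ)v at the true
rates (`load_le_of_close`, `lpObj_ge_of_close`). By Hoeffding's inequality this accuracy has
probability at least 1-ε (`arrExp_accurate_ge`).

A packet is lost only if, on some link of its walk, at least C other packets selected the link in
the same slot. That event does not mention who is alive or the processing order, and its indicator
is at most (1+ε)^(count-C). Choices are independent given the arrivals and arrivals are independent
binomials, so the exponential moment factorizes (`prodExp_penalty`, `binExp_size_biased_le`) and is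
at most exp(εC/(1+ε)). The capacity hypothesis makes each such term at most ε/L (`chernoff_bound`).
A walk has at most L network links, so a further factor 1-ε is lost. The forwarding variables depend
on arrivals before the phase only; resampling the later coordinates (`prodExp_resample`) plays the
role of conditioning.

Summation (`core_sum_ge`). Slots that are not core lie in phase 0 or near a phase boundary, and the
radii decay like 1/√T_φ with T_φ doubling, so their sum is geometric. Both losses are O(ε)T for the
assumed horizon. Finally (1-10ε)(1+ε)² ≤ (1-ε)²(1-3ε/2). -/

/-- The expectation of `F` under the product of the weights `b q` on the finite sets `S q`. -/
def prodExp {Q : Type*} [Fintype Q] {κ : Q → Type*} (S : ∀ q, Finset (κ q)) (b : ∀ q, κ q → ℝ)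
    (F : (∀ q, κ q) → ℝ) : ℝ :=
  ∑ x ∈ Fintype.piFinset S, (∏ q, b q (x q)) * F x

/-! ### Expectations under finite product weights -/

section ProdExp

variable {Q : Type*} [Fintype Q] {κ : Q → Type*} {S : ∀ q, Finset (κ q)} {b : ∀ q, κ q → ℝ}

theorem prodExp_prod (g : ∀ q, κ q → ℝ) :
    prodExp S b (fun x => ∏ q, g q (x q)) = ∏ q, ∑ m ∈ S q, b q m * g q m := by
  rw [Finset.prod_univ_sum]
  exact Finset.sum_congr rfl fun x _ => Finset.prod_mul_distrib.symm

theorem prodExp_mono (hb : ∀ q, ∀ m ∈ S q, 0 ≤ b q m) {F G : (∀ q, κ q) → ℝ}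
    (h : ∀ x ∈ Fintype.piFinset S, F x ≤ G x) : prodExp S b F ≤ prodExp S b G :=
  Finset.sum_le_sum fun x hx => mul_le_mul_of_nonneg_left (h x hx)
    (Finset.prod_nonneg fun q _ => hb q _ (Fintype.mem_piFinset.1 hx q))

theorem prodExp_congr {F G : (∀ q, κ q) → ℝ}
    (h : ∀ x ∈ Fintype.piFinset S, F x = G x) : prodExp S b F = prodExp S b G :=
  Finset.sum_congr rfl fun x hx => by rw [h x hx]

theorem prodExp_add (F G : (∀ q, κ q) → ℝ) :
    prodExp S b (fun x => F x + G x) = prodExp S b F + prodExp S b G := by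
  simp only [prodExp, mul_add, Finset.sum_add_distrib]

theorem prodExp_sub (F G : (∀ q, κ q) → ℝ) :
    prodExp S b (fun x => F x - G x) = prodExp S b F - prodExp S b G := by
  simp only [prodExp, mul_sub, Finset.sum_sub_distrib]

theorem prodExp_const_mul (a : ℝ) (F : (∀ q, κ q) → ℝ) :
    prodExp S b (fun x => a * F x) = a * prodExp S b F := by
  simp only [prodExp, Finset.mul_sum]
  exact Finset.sum_congr rfl fun x _ => by ring

theorem prodExp_sum {ι : Type*} (s : Finset ι) (F : ι → (∀ q, κ q) → ℝ) :
    prodExp S b (fun x => ∑ i ∈ s, F i x) = ∑ i ∈ s, prodExp S b (F i) := by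
  simp only [prodExp, Finset.mul_sum]
  exact Finset.sum_comm

theorem prodExp_one (hs : ∀ q, ∑ m ∈ S q, b q m = 1) : prodExp S b (fun _ => 1) = 1 := by
  have := prodExp_prod (S := S) (b := b) (fun _ _ => 1)
  simpa [hs] using this

theorem prodExp_const (hs : ∀ q, ∑ m ∈ S q, b q m = 1) (a : ℝ) :
    prodExp S b (fun _ => a) = a := by
  have := prodExp_const_mul (S := S) (b := b) a (fun _ => 1)
  simpa [prodExp_one hs] using this

theorem prodExp_nonneg (hb : ∀ q, ∀ m ∈ S q, 0 ≤ b q m) {F : (∀ q, κ q) → ℝ}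
    (h : ∀ x ∈ Fintype.piFinset S, 0 ≤ F x) : 0 ≤ prodExp S b F :=
  Finset.sum_nonneg fun x hx => mul_nonneg
    (Finset.prod_nonneg fun q _ => hb q _ (Fintype.mem_piFinset.1 hx q)) (h x hx)

theorem prodExp_eval (hs : ∀ q, ∑ m ∈ S q, b q m = 1) (q₀ : Q) (h : κ q₀ → ℝ) :
    prodExp S b (fun x => h (x q₀)) = ∑ m ∈ S q₀, b q₀ m * h m := by
  have := prodExp_prod (S := S) (b := b)
    (fun q m => if e : q = q₀ then h (e ▸ m) else 1)
  rw [Finset.prod_eq_single q₀ (fun q _ hq => by simp [hq, hs]) (by simp)] at this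
  simp only [dite_true] at this
  rw [← this]
  refine prodExp_congr fun x _ => ?_
  rw [Finset.prod_eq_single q₀ (fun q _ hq => by simp [hq]) (by simp)]
  simp

/-- The coordinates outside `U` can be drawn afresh. -/
theorem prodExp_resample (hs : ∀ q, ∑ m ∈ S q, b q m = 1) (U : Q → Prop) (F : (∀ q, κ q) → ℝ) :
    prodExp S b F = prodExp S b fun x => prodExp S b fun y =>
      F (fun q => if U q then x q else y q) := by
  have h1 : prodExp S b F = ∑ z ∈ Fintype.piFinset S ×ˢ Fintype.piFinset S,
      (∏ q, b q (z.1 q)) * ((∏ q, b q (z.2 q)) * F z.1) := by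
    rw [Finset.sum_product]
    refine Finset.sum_congr rfl fun x _ => ?_
    exact (congrArg _ (prodExp_const hs (F x)).symm).trans (Finset.mul_sum _ _ _)
  have h2 : (prodExp S b fun x => prodExp S b fun y => F (fun q => if U q then x q else y q)) =
      ∑ z ∈ Fintype.piFinset S ×ˢ Fintype.piFinset S, (∏ q, b q (z.1 q)) *
        ((∏ q, b q (z.2 q)) * F (fun q => if U q then z.1 q else z.2 q)) := by
    rw [Finset.sum_product]
    simp only [prodExp, Finset.mul_sum]
  rw [h1, h2]
  symm
  -- Exchanging the coordinates outside `U` between two independent samples is an involution that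
  -- preserves the product of their weights.
  refine Finset.sum_nbij' (fun z => (fun q => if U q then z.1 q else z.2 q,
      fun q => if U q then z.2 q else z.1 q))
    (fun z => (fun q => if U q then z.1 q else z.2 q,
      fun q => if U q then z.2 q else z.1 q)) ?_ ?_ ?_ ?_ ?_
  · intro z hz
    simp only [Finset.mem_product, Fintype.mem_piFinset] at hz ⊢
    exact ⟨fun q => by split_ifs; exacts [hz.1 q, hz.2 q],
      fun q => by split_ifs; exacts [hz.2 q, hz.1 q]⟩
  · intro z hz
    simp only [Finset.mem_product, Fintype.mem_piFinset] at hz ⊢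
    exact ⟨fun q => by split_ifs; exacts [hz.1 q, hz.2 q],
      fun q => by split_ifs; exacts [hz.2 q, hz.1 q]⟩
  · intro z _
    ext q <;> by_cases h : U q <;> simp [h]
  · intro z _
    ext q <;> by_cases h : U q <;> simp [h]
  · intro z _
    simp only [← mul_assoc, ← Finset.prod_mul_distrib]
    congr 1
    refine Finset.prod_congr rfl fun q _ => ?_
    by_cases h : U q <;> simp [h, mul_comm]

end ProdExp

/-! ### Binomial weights: generating functions, integrals, concentration -/

/-- The probability of `m` under the binomial distribution. -/
def binomialWeight (n : ℕ) (p : ℝ) (m : ℕ) : ℝ := n.choose m * p ^ m * (1 - p) ^ (n - m)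

theorem binomialWeight_nonneg (n : ℕ) {p : ℝ} (h0 : 0 ≤ p) (h1 : p ≤ 1) (m : ℕ) :
    0 ≤ binomialWeight n p m := by
  have := sub_nonneg.2 h1
  unfold binomialWeight
  positivity

theorem sum_binomialWeight_mul_pow (n : ℕ) (p x : ℝ) :
    ∑ m ∈ Finset.range (n + 1), binomialWeight n p m * x ^ m = (1 + p * (x - 1)) ^ n := by
  have : (1 + p * (x - 1)) = p * x + (1 - p) := by ring
  rw [this, add_pow]
  refine Finset.sum_congr rfl fun m _ => ?_
  rw [binomialWeight, mul_pow]
  ring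

theorem sum_binomialWeight (n : ℕ) (p : ℝ) :
    ∑ m ∈ Finset.range (n + 1), binomialWeight n p m = 1 := by
  simpa using sum_binomialWeight_mul_pow n p 1

/-- This is x times the derivative in x of the previous generating function; termwise it is the
absorption identity for binomial coefficients. -/
theorem sum_binomialWeight_mul_id_mul_pow (n : ℕ) (p x : ℝ) :
    ∑ m ∈ Finset.range (n + 1), binomialWeight n p m * (m * x ^ m) =
      n * p * x * (1 + p * (x - 1)) ^ (n - 1) := by
  cases n with
  | zero => simp
  | succ n =>
    rw [Finset.sum_range_succ', Nat.add_sub_cancel, ← sum_binomialWeight_mul_pow, Finset.mul_sum]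
    simp only [Nat.cast_zero, zero_mul, mul_zero, add_zero]
    refine Finset.sum_congr rfl fun m _ => ?_
    have h : ((n + 1 : ℕ) : ℝ) * n.choose m = (n + 1).choose (m + 1) * ((m + 1 : ℕ) : ℝ) := by
      exact_mod_cast Nat.add_one_mul_choose_eq n m
    rw [binomialWeight, binomialWeight, Nat.add_sub_add_right]
    linear_combination (-(p ^ (m+1) * (1 - p) ^ (n - m) * x ^ (m+1))) * h

theorem sum_binomialWeight_mul_id (n : ℕ) (p : ℝ) :
    ∑ m ∈ Finset.range (n + 1), binomialWeight n p m * m = n * p := by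
  simpa using sum_binomialWeight_mul_id_mul_pow n p 1

section BinomialProduct

variable {Q : Type*} [Fintype Q] (n : Q → ℕ) (p : Q → ℝ)

/-- The expectation under independent binomial variables. -/
abbrev binExp (F : (Q → ℕ) → ℝ) : ℝ :=
  prodExp (fun q => Finset.range (n q + 1)) (fun q => binomialWeight (n q) (p q)) F

/-- The left side is the expected sum, over the packets counted by `x q₀`, of the product of the
factors of all other packets: hence one factor `X q₀` is removed. Size-biasing a binomial leaves n-1
trials besides the marked one, and since the base is at least 1 the bound for n trials still
applies. -/
theorem binExp_size_biased_le (h0 : ∀ q, 0 ≤ p q) (hp1 : ∀ q, p q ≤ 1) (X : Q → ℝ) (hX : ∀ q, 1 ≤ X q) (q₀ : Q) :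
    binExp n p (fun x => x q₀ * ((X q₀)⁻¹ * ∏ q, X q ^ x q)) ≤
      n q₀ * p q₀ * Real.exp (∑ q, n q * p q * (X q - 1)) := by
  have hX0 : (0 : ℝ) < X q₀ := zero_lt_one.trans_le (hX q₀)
  have hb : ∀ q, 1 ≤ 1 + p q * (X q - 1) := fun q => by nlinarith [h0 q, hX q]
  have h1 : binExp n p (fun x => x q₀ * ((X q₀)⁻¹ * ∏ q, X q ^ x q)) =
      binExp n p (fun x => ∏ q, (X q ^ x q * if q = q₀ then (x q : ℝ) * (X q)⁻¹ else 1)) := by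
    refine prodExp_congr fun x _ => ?_
    rw [Finset.prod_mul_distrib, Finset.prod_ite_eq' Finset.univ q₀]
    simp
    ring
  have h2 : ∀ q, ∑ m ∈ Finset.range (n q + 1), binomialWeight (n q) (p q) m *
      (X q ^ m * if q = q₀ then (m : ℝ) * (X q)⁻¹ else 1) ≤
      Real.exp (n q * p q * (X q - 1)) * if q = q₀ then (n q * p q : ℝ) else 1 := by
    intro q
    have he : (1 + p q * (X q - 1)) ^ n q ≤ Real.exp (n q * p q * (X q - 1)) := by
      have : Real.exp (n q * p q * (X q - 1)) = Real.exp (p q * (X q - 1)) ^ n q := by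
        rw [← Real.exp_nat_mul]; ring_nf
      rw [this]
      refine pow_le_pow_left₀ (by linarith [hb q]) ?_ _
      rw [add_comm]
      exact Real.add_one_le_exp _
    split_ifs with h
    · have h3 : ∑ m ∈ Finset.range (n q + 1), binomialWeight (n q) (p q) m *
          (X q ^ m * ((m : ℝ) * (X q)⁻¹)) =
          (X q)⁻¹ * ∑ m ∈ Finset.range (n q + 1), binomialWeight (n q) (p q) m *
            (m * X q ^ m) := by
        rw [Finset.mul_sum]
        exact Finset.sum_congr rfl fun m _ => by ring
      rw [h3, sum_binomialWeight_mul_id_mul_pow]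
      have hXq : X q ≠ 0 := by rw [h]; exact hX0.ne'
      have h4 : (X q)⁻¹ * (n q * p q * X q * (1 + p q * (X q - 1)) ^ (n q - 1)) =
        (1 + p q * (X q - 1)) ^ (n q - 1) * (n q * p q) := by
        field_simp
      rw [h4]
      refine mul_le_mul_of_nonneg_right ?_ (mul_nonneg (Nat.cast_nonneg _) (h0 q))
      exact (pow_le_pow_right₀ (hb q) (Nat.sub_le _ _)).trans he
    · simp only [mul_one]
      rw [sum_binomialWeight_mul_pow]
      exact he
  rw [h1, binExp, prodExp_prod (S := fun q => Finset.range (n q + 1))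
    (fun q m => X q ^ m * if q = q₀ then (m : ℝ) * (X q)⁻¹ else 1)]
  refine (Finset.prod_le_prod (fun q _ => Finset.sum_nonneg fun m _ => ?_)
    (fun q _ => h2 q)).trans ?_
  · have := hX q
    refine mul_nonneg (binomialWeight_nonneg _ (h0 q) (hp1 q) m) ?_
    split_ifs <;> positivity
  · rw [Finset.prod_mul_distrib, Finset.prod_ite_eq' Finset.univ q₀, ← Real.exp_sum]
    simp [mul_comm]

-- Independence makes the joint law a product measure, and binomial variables put it on a finite
-- box. Every integral over the arrivals is therefore a finite sum, with no integrability condition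
-- on `F`.
open MeasureTheory ProbabilityTheory in
theorem integral_eq_binExp {Ω : Type*} [MeasurableSpace Ω] {P : Measure Ω}
    [IsProbabilityMeasure P] {X : Q → Ω → ℕ} {r : Q → unitInterval}
    (hX : ∀ q, HasLaw (X q) (binomial (n q) (r q)) P) (hi : iIndepFun X P)
    (F : (Q → ℕ) → ℝ) :
    ∫ ω, F (fun q => X q ω) ∂P = binExp n (fun q => (r q : ℝ)) F := by
  have hm : ∀ q, AEMeasurable (X q) P := fun q => (hX q).aemeasurable
  have hlaw := (iIndepFun_iff_map_fun_eq_pi_map hm).1 hi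
  have hm' : AEMeasurable (fun ω q => X q ω) P := aemeasurable_pi_iff.2 hm
  have hF : Measurable F := measurable_of_countable F
  have h1 : ∫ ω, F (fun q => X q ω) ∂P = ∫ x, F x ∂(P.map fun ω q => X q ω) :=
    (integral_map hm' hF.aestronglyMeasurable).symm
  set B := Fintype.piFinset fun q => Finset.range (n q + 1) with hB
  have hbox : ∀ᵐ x ∂(P.map fun ω q => X q ω), x ∈ (B : Set (Q → ℕ)) := by
    rw [ae_map_iff hm' (Set.to_countable _).measurableSet]
    have : ∀ᵐ ω ∂P, ∀ q, X q ω ≤ n q := by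
      rw [ae_all_iff]
      exact fun q => ae_le_of_hasLaw_binomial (hX q)
    filter_upwards [this] with ω hω
    simp only [hB, Finset.mem_coe, Fintype.mem_piFinset, Finset.mem_range]
    exact fun q => Nat.lt_succ_of_le (hω q)
  have : IsProbabilityMeasure (P.map fun ω q => X q ω) := Measure.isProbabilityMeasure_map hm'
  rw [h1, ← setIntegral_eq_integral_of_ae_compl_eq_zero (s := (B : Set (Q → ℕ)))
    (hbox.mono fun x hx h => absurd hx h),
    setIntegral_finset _ IntegrableOn.finset]
  refine Finset.sum_congr rfl fun x _ => ?_
  rw [smul_eq_mul, hlaw, measureReal_def, Measure.pi_singleton, ENNReal.toReal_prod]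
  congr 1
  refine Finset.prod_congr rfl fun q _ => ?_
  rw [(hX q).map_eq, ← measureReal_def, binomial_real_singleton]
  rfl

-- Each variable lies in [0, m], so its centred version is sub-Gaussian with parameter (m/2)². The
-- two one-sided tails account for the factor 2.
open MeasureTheory ProbabilityTheory in
theorem hoeffding_binomial {Ω : Type*} [MeasurableSpace Ω] {P : Measure Ω}
    [IsProbabilityMeasure P] {X : Q → Ω → ℕ} {m : ℕ} {r : unitInterval} 
    (hX : ∀ q, HasLaw (X q) (binomial m r) P) (hi : iIndepFun X P) {c : ℝ} (hc : 0 ≤ c) :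
    P.real {ω | c ≤ |∑ q, (X q ω : ℝ) - Fintype.card Q * (m * r)|} ≤
      2 * Real.exp (-(2 * c ^ 2) / (Fintype.card Q * m ^ 2)) := by
  set Y : Q → Ω → ℝ := fun q ω => (X q ω : ℝ) - m * r with hY
  have hcast : ∀ g : ℕ → ℝ, Measurable g := fun g => measurable_of_countable g
  have hiY : iIndepFun Y P := hi.comp (fun q x => (x : ℝ) - m * r) fun q => hcast _
  have hmean : ∀ q, ∫ ω, (X q ω : ℝ) ∂P = m * r := by
    intro q
    have h := (hX q).integral_comp (f := fun x : ℕ => (x : ℝ)) (hcast _).aestronglyMeasurable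
    rw [integral_binomial] at h
    refine h.trans ?_
    rw [← sum_binomialWeight_mul_id, Nat.range_succ_eq_Iic]
    rfl
  have hsub : ∀ q, HasSubgaussianMGF (Y q) ((‖(m : ℝ) - 0‖₊ / 2) ^ 2) P := by
    intro q
    have := hasSubgaussianMGF_of_mem_Icc (μ := P) (X := fun ω => (X q ω : ℝ)) (a := 0) (b := m)
      ((hcast _).comp_aemeasurable (hX q).aemeasurable) (by
        filter_upwards [ae_le_of_hasLaw_binomial (hX q)] with ω hω
        exact ⟨Nat.cast_nonneg _, by exact_mod_cast hω⟩)
    rwa [hmean q] at this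
  have h1 := HasSubgaussianMGF.measure_sum_ge_le_of_iIndepFun hiY (s := Finset.univ)
    (fun q _ => hsub q) hc
  have hiN : iIndepFun (fun q => -Y q) P := hiY.comp (fun q x => -x) fun q => measurable_neg
  have h2 := HasSubgaussianMGF.measure_sum_ge_le_of_iIndepFun hiN (s := Finset.univ)
    (fun q _ => (hsub q).neg) hc
  have he : (-c ^ 2 / (2 * ((∑ q : Q, (‖(m : ℝ) - 0‖₊ / 2) ^ 2 : NNReal) : ℝ))) =
      -(2 * c ^ 2) / (Fintype.card Q * m ^ 2) := by
    simp
    field_simp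
  rw [he] at h1 h2
  have hsum : ∀ ω, ∑ q, Y q ω = ∑ q, (X q ω : ℝ) - Fintype.card Q * (m * r) := by
    intro ω
    simp [hY, Finset.sum_sub_distrib]
  have hset : {ω | c ≤ |∑ q, (X q ω : ℝ) - Fintype.card Q * (m * r)|} ⊆
      {ω | c ≤ ∑ q, Y q ω} ∪ {ω | c ≤ ∑ q, (-Y q) ω} := by
    intro ω hω
    simp only [Set.mem_ofPred_eq, ← hsum, le_abs] at hω
    simpa [Finset.sum_neg_distrib] using hω
  calc _ ≤ _ := measureReal_mono hset
    _ ≤ _ := measureReal_union_le _ _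
    _ ≤ _ := by linarith

end BinomialProduct

namespace Network

/-! ### The law of a packet's walk under hop-by-hop forwarding -/

section WalkLaw

variable {V : Type u} [Fintype V] {N : Network V}

/-- The probability of a sequence of `n + 1` links under probabilistic forwarding (`0` unless the
links are extended links that form a walk). -/
def seqProb (f : N.Fwd) (j : Fin N.J) (n : ℕ) (e : Fin (n + 1) → V × V) : ℝ :=
  (if N.Ext (e 0) then f j (e 0) 0 else 0) * ∏ τ : Fin n,
    if N.Ext (e τ.succ) ∧ (e τ.castSucc).2 = (e τ.succ).1 then
      f j (e τ.succ) (τ + 1) / ∑ ℓ ∈ N.outLinks (e τ.succ).1, f j ℓ (τ + 1) else 0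

theorem seqProb_snoc (f : N.Fwd) (j : Fin N.J) (n : ℕ) (e : Fin (n + 1) → V × V) (ℓ : V × V) :
    seqProb f j (n + 1) (Fin.snoc (α := fun _ => V × V) e ℓ) = seqProb f j n e *
      if N.Ext ℓ ∧ (e (Fin.last n)).2 = ℓ.1 then
        f j ℓ (n + 1) / ∑ ℓ' ∈ N.outLinks ℓ.1, f j ℓ' (n + 1) else 0 := by
  unfold seqProb
  rw [Fin.prod_univ_castSucc, mul_assoc]
  congr 2
  · refine Finset.prod_congr rfl fun τ _ => ?_
    simp only [Fin.succ_castSucc, Fin.snoc_castSucc, Fin.val_castSucc]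
  · simp only [Fin.succ_last, Fin.snoc_last, Fin.snoc_castSucc, Fin.val_last]

theorem sum_snoc {α : Type*} [Fintype α] {n : ℕ} (G : (Fin (n + 1) → α) → ℝ) :
    ∑ e, G e = ∑ e : Fin n → α, ∑ a, G (Fin.snoc (α := fun _ => α) e a) := by
  rw [← (Fin.snocEquiv fun _ => α).sum_comp, Fintype.sum_prod_type, Finset.sum_comm]
  rfl

theorem deadline_le_dmax {V : Type u} (N : Network V) (j : Fin N.J) : N.deadline j ≤ N.dmax :=
  Finset.le_sup (f := N.deadline) (Finset.mem_univ j)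

namespace LPFeasible

variable {r : Fin N.J → ℝ} {ε η : ℝ} {f : N.Fwd}

theorem out_nonneg (hf : N.LPFeasible r ε η f) (j : Fin N.J) {τ : ℕ} (hτ : τ ≤ N.dmax) (v : V) :
    0 ≤ ∑ ℓ ∈ N.outLinks v, f j ℓ τ :=
  Finset.sum_nonneg fun ℓ hℓ => hf.nonneg j ℓ τ (Finset.mem_filter.1 hℓ).2.1 hτ

theorem seqProb_nonneg (hf : N.LPFeasible r ε η f) (j : Fin N.J) {n : ℕ} (hn : n ≤ N.deadline j)
    (e : Fin (n + 1) → V × V) : 0 ≤ seqProb f j n e := by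
  have hd := N.deadline_le_dmax j
  refine mul_nonneg ?_ (Finset.prod_nonneg fun τ _ => ?_)
  · split_ifs with h
    · exact hf.nonneg j _ 0 h (Nat.zero_le _)
    · exact le_rfl
  · have := τ.2
    split_ifs with h
    · exact div_nonneg (hf.nonneg j _ _ h.1 (by omega)) (hf.out_nonneg j (by omega) _)
    · exact le_rfl

theorem eq_zero_of_out_eq_zero (hf : N.LPFeasible r ε η f) (j : Fin N.J) {τ : ℕ}
    (hτ : τ ≤ N.dmax) {ℓ : V × V} (hℓ : N.Ext ℓ)
    (h : ∑ ℓ' ∈ N.outLinks ℓ.1, f j ℓ' τ = 0) : f j ℓ τ = 0 :=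
  (Finset.sum_eq_zero_iff_of_nonneg fun ℓ' hℓ' =>
    hf.nonneg j ℓ' τ (Finset.mem_filter.1 hℓ').2.1 hτ).1 h ℓ
    (Finset.mem_filter.2 ⟨Finset.mem_univ _, hℓ, rfl⟩)

theorem sum_next (f : N.Fwd) (j : Fin N.J) (n : ℕ) (v : V) :
    ∑ ℓ, (if N.Ext ℓ ∧ v = ℓ.1 then
      f j ℓ (n + 1) / ∑ ℓ' ∈ N.outLinks ℓ.1, f j ℓ' (n + 1) else 0) =
    (∑ ℓ ∈ N.outLinks v, f j ℓ (n + 1)) / ∑ ℓ ∈ N.outLinks v, f j ℓ (n + 1) := by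
  rw [← Finset.sum_filter, Finset.sum_div, outLinks]
  refine Finset.sum_congr (by ext; simp [eq_comm]) fun ℓ hℓ => ?_
  rw [(Finset.mem_filter.1 hℓ).2.2]
  rfl

/-- The probability that a packet selects the extended link `ℓ` at age `τ`. -/
theorem sum_seqProb (hf : N.LPFeasible r ε η f) (j : Fin N.J) (n : ℕ) (hn : n ≤ N.deadline j)
    (τ : Fin (n + 1)) (ℓ : V × V) (hℓ : N.Ext ℓ) :
    ∑ e : Fin (n + 1) → V × V, (if e τ = ℓ then seqProb f j n e else 0) = f j ℓ τ := by
  -- Induction on the length of the prefix, which is why `seqProb` is defined for every length and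
  -- not only for complete walks.
  induction n generalizing ℓ with
  | zero =>
    rw [← (Equiv.funUnique (Fin 1) (V × V)).symm.sum_comp]
    obtain rfl : τ = 0 := by omega
    simp [seqProb, hℓ, uniqueElim_const, Equiv.funUnique]
  | succ n ih =>
    have hd := N.deadline_le_dmax j
    have ih' := ih (by omega)
    rw [sum_snoc]
    simp only [seqProb_snoc]
    induction τ using Fin.lastCases with
    | last =>
      simp only [Fin.snoc_last, Fin.val_last]
      -- At the newest age the link is reached through the links into its tail. By induction their
      -- total mass is the inflow at age n, which conservation equates with the denominator of the
      -- transition probability.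
      have h1 : ∀ e : Fin (n + 1) → V × V, (∑ a : V × V, if a = ℓ then seqProb f j n e *
          (if N.Ext a ∧ (e (Fin.last n)).2 = a.1 then
            f j a (n + 1) / ∑ ℓ' ∈ N.outLinks a.1, f j ℓ' (n + 1) else 0) else 0) =
          (f j ℓ (n + 1) / ∑ ℓ' ∈ N.outLinks ℓ.1, f j ℓ' (n + 1)) *
          ∑ a ∈ N.inLinks ℓ.1, if e (Fin.last n) = a then seqProb f j n e else 0 := by
        intro e
        rw [Finset.sum_ite_eq' Finset.univ ℓ, if_pos (Finset.mem_univ _), Finset.sum_ite_eq]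
        by_cases h2 : (e (Fin.last n)).2 = ℓ.1
        · by_cases h3 : N.Ext (e (Fin.last n))
          · simp [inLinks, h2, h3, hℓ, mul_comm]
          · have h4 : seqProb f j n e = 0 := by
              cases n with
              | zero => simp [seqProb] at h3 ⊢; simp [h3]
              | succ n =>
                rw [seqProb, Fin.prod_univ_castSucc]
                simp [h3]
            simp [h4]
        · simp [inLinks, h2]
      simp only [h1]
      rw [← Finset.mul_sum, Finset.sum_comm]
      have h5 : ∑ a ∈ N.inLinks ℓ.1, ∑ e : Fin (n + 1) → V × V,
          (if e (Fin.last n) = a then seqProb f j n e else 0) =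
          ∑ ℓ' ∈ N.outLinks ℓ.1, f j ℓ' (n + 1) := by
        rw [← hf.conserve j ℓ.1 n (by omega)]
        refine Finset.sum_congr rfl fun a ha => ?_
        exact ih' (Fin.last n) a (Finset.mem_filter.1 ha).2.1
      rw [h5]
      by_cases h6 : ∑ ℓ' ∈ N.outLinks ℓ.1, f j ℓ' (n + 1) = 0
      · rw [h6, mul_zero, hf.eq_zero_of_out_eq_zero j (by omega) hℓ h6]
      · rw [div_mul_cancel₀ _ h6]
    | cast τ =>
      simp only [Fin.snoc_castSucc, Fin.val_castSucc]
      rw [← ih' τ ℓ hℓ]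
      refine Finset.sum_congr rfl fun e _ => ?_
      split_ifs with h1
      · rw [← Finset.mul_sum, sum_next]
        -- At an earlier age the last link is summed out. Where the outflow vanishes the transition
        -- ratios are 0/0 = 0 and do not sum to 1, but then the inflow vanishes too, so the prefix
        -- already has probability 0.
        by_cases h6 : ∑ ℓ' ∈ N.outLinks (e (Fin.last n)).2, f j ℓ' (n + 1) = 0
        · have h7 : seqProb f j n e = 0 := by
            by_cases h3 : N.Ext (e (Fin.last n))
            · have h8 := hf.conserve j (e (Fin.last n)).2 n (by omega)
              rw [h6, Finset.sum_eq_zero_iff_of_nonneg fun ℓ' hℓ' =>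
                hf.nonneg j ℓ' n (Finset.mem_filter.1 hℓ').2.1 (by omega)] at h8
              have h9 := ih' (Fin.last n) _ h3
              rw [Fin.val_last, h8 _ (Finset.mem_filter.2 ⟨Finset.mem_univ _, h3, rfl⟩),
                Finset.sum_eq_zero_iff_of_nonneg] at h9
              · simpa using h9 e (Finset.mem_univ _)
              · intro e' _
                change (0 : ℝ) ≤ _
                split_ifs
                exacts [hf.seqProb_nonneg j (by omega) e', le_rfl]
            · cases n with
              | zero => simp [seqProb] at h3 ⊢; simp [h3]
              | succ n =>
                rw [seqProb, Fin.prod_univ_castSucc]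
                simp [h3]
          rw [h7, zero_mul]
        · rw [div_self h6, mul_one]
      · simp

theorem walkProb_some (f : N.Fwd) (j : Fin N.J) (w : N.Walk j) :
    walkProb f j (some w) = seqProb f j (N.deadline j) w.edge := by
  simp only [walkProb, seqProb, w.edge_ext, w.chain, if_true, true_and]

/-- Sequences that are not walks carry no mass: `seqProb` kills those that are not chains of
extended links, and the constraint `start` kills those that begin elsewhere than at the source. -/
theorem sum_walk (hf : N.LPFeasible r ε η f) (j : Fin N.J)
    (g : (Fin (N.deadline j + 1) → V × V) → ℝ) :
    ∑ w : N.Walk j, g w.edge * walkProb f j (some w) =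
      ∑ e, g e * seqProb f j (N.deadline j) e := by
  simp only [walkProb_some]
  refine (Finset.sum_map Finset.univ ⟨_, Walk.edge_injective j⟩
    (fun e => g e * seqProb f j (N.deadline j) e)).symm.trans ?_
  refine Finset.sum_subset (Finset.subset_univ _) fun e _ he => ?_
  suffices seqProb f j (N.deadline j) e = 0 by rw [this, mul_zero]
  by_contra h
  apply he
  have h1 := left_ne_zero_of_mul h
  have h2 := fun τ => Finset.prod_ne_zero_iff.1 (right_ne_zero_of_mul h) τ (Finset.mem_univ _)
  have h0 : N.Ext (e 0) := by
    by_contra h3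
    simp [h3] at h1
  have h3 : ∀ τ : Fin (N.deadline j), N.Ext (e τ.succ) ∧ (e τ.castSucc).2 = (e τ.succ).1 := by
    intro τ
    by_contra h4
    exact h2 τ (if_neg h4)
  have hs : e 0 ∈ N.outLinks (N.src j) := by
    by_contra h4
    rw [if_pos h0] at h1
    exact h1 (hf.start j _ h0 h4)
  exact Finset.mem_map.2 ⟨⟨e, Fin.cases h0 fun τ => (h3 τ).1, (Finset.mem_filter.1 hs).2.2,
    fun τ => (h3 τ).2⟩, Finset.mem_univ _, rfl⟩

theorem walkProb_some_nonneg (hf : N.LPFeasible r ε η f) (j : Fin N.J) (w : N.Walk j) :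
    0 ≤ walkProb f j (some w) := by
  rw [walkProb_some]
  exact hf.seqProb_nonneg j le_rfl _

theorem walkProb_nonneg (hf : N.LPFeasible r ε η f) (j : Fin N.J) (o : Option (N.Walk j)) :
    0 ≤ walkProb f j o := by
  cases o with
  | none => exact sub_nonneg.2 (hf.one_choice j)
  | some w => exact hf.walkProb_some_nonneg j w

theorem sum_walkProb_edge (hf : N.LPFeasible r ε η f) (j : Fin N.J)
    (τ : Fin (N.deadline j + 1)) (ℓ : V × V) (hℓ : N.Ext ℓ) :
    ∑ w : N.Walk j, (if w.edge τ = ℓ then walkProb f j (some w) else 0) = f j ℓ τ := by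
  rw [← hf.sum_seqProb j _ le_rfl τ ℓ hℓ]
  have := hf.sum_walk j (fun e => if e τ = ℓ then 1 else 0)
  simpa only [ite_mul, one_mul, zero_mul] using this

theorem sum_walkProb_some (hf : N.LPFeasible r ε η f) (j : Fin N.J) :
    ∑ w : N.Walk j, walkProb f j (some w) = ∑ ℓ ∈ N.outLinks (N.src j), f j ℓ 0 := by
  have h1 : ∑ ℓ ∈ N.outLinks (N.src j), f j ℓ 0 = ∑ ℓ ∈ N.outLinks (N.src j),
      ∑ w : N.Walk j, (if w.edge 0 = ℓ then walkProb f j (some w) else 0) :=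
    Finset.sum_congr rfl fun ℓ hℓ =>
      (hf.sum_walkProb_edge j 0 ℓ (Finset.mem_filter.1 hℓ).2.1).symm
  rw [h1, Finset.sum_comm]
  refine Finset.sum_congr rfl fun w _ => ?_
  rw [Finset.sum_ite_eq, if_pos]
  exact Finset.mem_filter.2 ⟨Finset.mem_univ _, w.edge_ext 0, w.start⟩

theorem sum_walkProb (hf : N.LPFeasible r ε η f) (j : Fin N.J) :
    ∑ o : Option (N.Walk j), walkProb f j o = 1 := by
  rw [Fintype.sum_option, hf.sum_walkProb_some j, walkProb]
  ring

/-- The constraint `finish` makes the marginal at the last age vanish on links that miss the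
destination, and that marginal is a sum of nonnegative walk probabilities. -/
theorem walkProb_eq_zero_of_not_arrives (hf : N.LPFeasible r ε η f) (j : Fin N.J)
    (w : N.Walk j) (hw : ¬ w.Arrives) : walkProb f j (some w) = 0 := by
  have h := hf.sum_walkProb_edge j (Fin.last _) (w.edge (Fin.last _)) (w.edge_ext _)
  rw [Fin.val_last, hf.finish j _ (w.edge_ext _) (fun hm => hw (Finset.mem_filter.1 hm).2.2),
    Finset.sum_eq_zero_iff_of_nonneg] at h
  · simpa using h w (Finset.mem_univ _)
  · intro w' _
    change (0 : ℝ) ≤ _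
    split_ifs
    exacts [hf.walkProb_some_nonneg j w', le_rfl]

theorem sum_walkProb_arrives (hf : N.LPFeasible r ε η f) (j : Fin N.J) :
    ∑ o : Option (N.Walk j), walkProb f j o * (if ∃ w, o = some w ∧ w.Arrives then 1 else 0) =
      ∑ ℓ ∈ N.outLinks (N.src j), f j ℓ 0 := by
  rw [Fintype.sum_option, ← hf.sum_walkProb_some j]
  simp only [reduceCtorEq, false_and, exists_false, if_false, mul_zero, zero_add,
    Option.some.injEq, exists_eq_left']
  refine Finset.sum_congr rfl fun w _ => ?_
  split_ifs with h
  · rw [mul_one]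
  · rw [hf.walkProb_eq_zero_of_not_arrives j w h, mul_zero]

/-- The expected number of links of the network selected by a packet is at most `maxLen` times the
probability that it is not dropped on arrival. -/
theorem sum_links_le (hf : N.LPFeasible r ε η f) (j : Fin N.J) :
    ∑ τ : Fin (N.deadline j + 1), ∑ ℓ ∈ N.links, f j ℓ τ ≤
      N.maxLen * ∑ ℓ ∈ N.outLinks (N.src j), f j ℓ 0 := by
  rw [← hf.sum_walkProb_some j, Finset.mul_sum]
  have h1 : ∑ τ : Fin (N.deadline j + 1), ∑ ℓ ∈ N.links, f j ℓ τ =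
      ∑ w : N.Walk j, ∑ τ : Fin (N.deadline j + 1),
        if w.edge τ ∈ N.links then walkProb f j (some w) else 0 := by
    refine Eq.trans (Finset.sum_congr rfl fun τ _ => ?_) Finset.sum_comm
    calc ∑ ℓ ∈ N.links, f j ℓ τ = ∑ ℓ ∈ N.links, ∑ w : N.Walk j,
          (if w.edge τ = ℓ then walkProb f j (some w) else 0) :=
        Finset.sum_congr rfl fun ℓ hℓ => (hf.sum_walkProb_edge j τ ℓ (Or.inl hℓ)).symm
      _ = _ := by
        rw [Finset.sum_comm]
        exact Finset.sum_congr rfl fun w _ => Finset.sum_ite_eq _ _ _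
  rw [h1]
  refine Finset.sum_le_sum fun w _ => ?_
  rw [← Finset.sum_filter, Finset.sum_const, nsmul_eq_mul]
  -- `maxLen` bounds only walks that reach the destination; the others have probability 0.
  by_cases hw : w.Arrives
  · refine mul_le_mul_of_nonneg_right ?_ (hf.walkProb_some_nonneg j w)
    have h2 : (Finset.univ.filter fun τ => w.edge τ ∈ N.links).card ≤ N.maxLen :=
      (Finset.le_sup (f := fun k : N.Route j =>
        (Finset.univ.filter fun τ => k.1.edge τ ∈ N.links).card)
        (Finset.mem_univ (⟨w, hw⟩ : N.Route j))).trans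
      (Finset.le_sup (f := fun j : Fin N.J => Finset.univ.sup fun k : N.Route j =>
        (Finset.univ.filter fun τ => k.1.edge τ ∈ N.links).card) (Finset.mem_univ j))
    exact_mod_cast h2
  · rw [hf.walkProb_eq_zero_of_not_arrives j w hw, mul_zero, mul_zero]

end LPFeasible

/-- The probability that a type-`j` packet that arrives in slot `t` selects `ℓ` for slot `s`. -/
def useProb (f : N.Fwd) (j : Fin N.J) (t s : ℕ) (ℓ : V × V) : ℝ :=
  if t ≤ s ∧ s ≤ t + N.deadline j then f j ℓ (s - t) else 0

theorem LPFeasible.useProb_nonneg {r : Fin N.J → ℝ} {ε η : ℝ} {f : N.Fwd}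
    (hf : N.LPFeasible r ε η f) (j : Fin N.J) (t s : ℕ) (ℓ : V × V) (hℓ : N.Ext ℓ) :
    0 ≤ useProb f j t s ℓ := by
  have hd := N.deadline_le_dmax j
  unfold useProb
  split_ifs with h
  · exact hf.nonneg j ℓ _ hℓ (by omega)
  · exact le_rfl

theorem LPFeasible.sum_walkProb_uses {r : Fin N.J → ℝ} {ε η : ℝ} {f : N.Fwd}
    (hf : N.LPFeasible r ε η f) (j : Fin N.J) (t s : ℕ) (ℓ : V × V) (hℓ : N.Ext ℓ) :
    ∑ o : Option (N.Walk j), walkProb f j o *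
      (if ∃ w, o = some w ∧ w.UsesAt t s ℓ then 1 else 0) = useProb f j t s ℓ := by
  rw [Fintype.sum_option]
  simp only [reduceCtorEq, false_and, exists_false, if_false, mul_zero, zero_add,
    Option.some.injEq, exists_eq_left', mul_ite, mul_one]
  unfold useProb
  split_ifs with h
  · rw [← hf.sum_walkProb_edge j ⟨s - t, by omega⟩ ℓ hℓ]
    refine Finset.sum_congr rfl fun w _ => ?_
    congr 1
    refine propext ⟨?_, fun hw => ⟨_, by simp; omega, hw⟩⟩
    rintro ⟨τ, rfl, hτ⟩
    convert hτ
    simp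
  · refine Finset.sum_eq_zero fun w _ => if_neg ?_
    rintro ⟨τ, rfl, -⟩
    have := τ.2
    omega

end WalkLaw
end Network

namespace Network

/-! ### Pathwise lower bound for the reward -/

section Pathwise

variable {V : Type u} {N : Network V} {T : ℕ} {α : N.Arrivals T}

/-- A packet is dropped when enough surviving packets ahead of it selected its link. Forgetting
survival and order only enlarges the count, so the conclusion involves independent selections alone.
-/
theorem exists_full_of_not_alive (c : Choice α) (prio : ℕ → Packet α → ℕ) (m : ℕ) (i : Packet α)
    (h : ¬ Alive c prio m i) :
    ∃ s < m, ∃ ℓ ∈ N.links, Selects c s i ℓ ∧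
      N.cap ℓ ≤ (Finset.univ.filter fun i' => i' ≠ i ∧ Selects c s i' ℓ).card := by
  induction m with
  | zero => exact absurd trivial h
  | succ m ih =>
    by_cases h1 : Alive c prio m i
    · simp only [Alive, h1, true_and, not_forall, not_lt] at h
      obtain ⟨ℓ, hℓ, hs, hc⟩ := h
      refine ⟨m, Nat.lt_succ_self m, ℓ, hℓ, hs, hc.trans (Finset.card_le_card ?_)⟩
      intro i' hi'
      simp only [Finset.mem_filter, Finset.mem_univ, true_and] at hi' ⊢
      refine ⟨?_, hi'.2.1⟩
      rintro rfl
      exact lt_irrefl _ hi'.2.2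
    · obtain ⟨s, hs, h2⟩ := ih h1
      exact ⟨s, hs.trans (Nat.lt_succ_self m), h2⟩

/-- All packets that are in the network together with a packet that arrives in slot `t` arrive in
the same phase, which is not phase `0`. -/
def IsCore (N : Network V) (ε : ℝ) (T t : ℕ) : Prop :=
  N.phaseOf ε T t ≠ 0 ∧ ∀ t', t' ≤ t + N.dmax → t ≤ t' + N.dmax → N.phaseOf ε T t' = N.phaseOf ε T t

/-- The overload penalty of packet `i` on link `ℓ` in slot `s`, with base `θ`. -/
def penalty (θ : ℝ) (r : Choice α) (i : Packet α) (s : ℕ) (ℓ : V × V) : ℝ :=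
  if Selects r s i ℓ then
    θ ^ (Finset.univ.filter fun i' => i' ≠ i ∧ Selects r s i' ℓ).card / θ ^ N.cap ℓ else 0

/-- A lower bound for the indicator of the delivery of packet `i`. -/
def gain (θ : ℝ) (r : Choice α) (i : Packet α) : ℝ :=
  (if ∃ w, r i = some w ∧ w.Arrives then 1 else 0) -
    ∑ τ : Fin (N.deadline i.type + 1), ∑ ℓ ∈ N.links, penalty θ r i (i.slot + τ) ℓ

theorem penalty_nonneg {θ : ℝ} (hθ : 1 ≤ θ) (r : Choice α) (i : Packet α) (s : ℕ) (ℓ : V × V) :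
    0 ≤ penalty θ r i s ℓ := by
  unfold penalty
  split_ifs <;> positivity

/-- If the packet is dropped, some link on its walk was selected by at least `cap` others, so one
penalty term is at least 1 and the right side, 0, is not exceeded. In a core slot all competitors
come from the same later phase, so the arbitrary algorithm of phase 0 has no influence. -/
theorem gain_le {θ : ℝ} (hθ : 1 ≤ θ) {ε : ℝ} (init : (α : N.Arrivals T) → Choice α → Choice α)
    (r : Choice α) (prio : ℕ → Packet α → ℕ) (i : Packet α) (hi : N.IsCore ε T i.slot) :
    gain θ r i ≤ if (∃ w, selection ε init α r i = some w ∧ w.Arrives) ∧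
      Alive (selection ε init α r) prio (i.slot + N.deadline i.type + 1) i then 1 else 0 := by
  have hθ0 : 0 < θ := zero_lt_one.trans_le hθ
  have hd := N.deadline_le_dmax
  have hsel : ∀ s, i.slot ≤ s → s ≤ i.slot + N.deadline i.type → ∀ i' : Packet α, ∀ ℓ,
      Selects (selection ε init α r) s i' ℓ → Selects r s i' ℓ := by
    rintro s hs1 hs2 i' ℓ ⟨w, hw, hu⟩
    have hu' := hu
    obtain ⟨τ, hτ, -⟩ := hu'
    have h1 := τ.2
    have h2 := hd i'.type
    have h3 := hd i.type
    have hp : N.phaseOf ε T i'.slot ≠ 0 := by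
      rw [hi.2 i'.slot (by omega) (by omega)]
      exact hi.1
    rw [selection, if_neg hp] at hw
    exact ⟨w, hw, hu⟩
  have hsi : selection ε init α r i = r i := if_neg hi.1
  have hpen : 0 ≤ ∑ τ : Fin (N.deadline i.type + 1), ∑ ℓ ∈ N.links,
      penalty θ r i (i.slot + τ) ℓ :=
    Finset.sum_nonneg fun τ _ => Finset.sum_nonneg fun ℓ _ => penalty_nonneg hθ r i _ ℓ
  rw [hsi, gain]
  by_cases hw : ∃ w, r i = some w ∧ w.Arrives
  · by_cases ha : Alive (selection ε init α r) prio (i.slot + N.deadline i.type + 1) i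
    · rw [if_pos hw, if_pos ⟨hw, ha⟩]
      linarith
    · rw [if_pos hw, if_neg fun h => ha h.2, sub_nonpos]
      obtain ⟨s, hs, ℓ, hℓ, hsl, hc⟩ := exists_full_of_not_alive _ _ _ _ ha
      have hs1 : i.slot ≤ s := by
        obtain ⟨w, _, τ, hτ, _⟩ := hsl
        omega
      have hs2 : s ≤ i.slot + N.deadline i.type := by omega
      have h1 : 1 ≤ penalty θ r i s ℓ := by
        rw [penalty, if_pos (hsel s hs1 hs2 i ℓ hsl), one_le_div (pow_pos hθ0 _)]
        refine pow_le_pow_right₀ hθ (hc.trans (Finset.card_le_card ?_))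
        intro i' hi'
        simp only [Finset.mem_filter, Finset.mem_univ, true_and] at hi' ⊢
        exact ⟨hi'.1, hsel s hs1 hs2 i' ℓ hi'.2⟩
      refine h1.trans ?_
      obtain ⟨τ, rfl⟩ : ∃ τ : Fin (N.deadline i.type + 1), s = i.slot + τ :=
        ⟨⟨s - i.slot, by omega⟩, by simp only; omega⟩
      refine le_trans ?_ (Finset.single_le_sum (f := fun τ : Fin (N.deadline i.type + 1) =>
        ∑ ℓ ∈ N.links, penalty θ r i (i.slot + τ) ℓ) (fun τ _ => Finset.sum_nonneg fun ℓ _ =>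
          penalty_nonneg hθ r i _ ℓ) (Finset.mem_univ τ))
      exact Finset.single_le_sum (f := fun ℓ => penalty θ r i _ ℓ)
        (fun ℓ _ => penalty_nonneg hθ r i _ ℓ) hℓ
  · rw [if_neg hw, if_neg fun h => hw h.1]
    linarith

/-- Packets outside `A` are bounded below by 0. Later `A` also encodes the accuracy of the
estimates. -/
theorem sum_gain_le_reward {θ : ℝ} (hθ : 1 ≤ θ) {ε : ℝ}
    (init : (α : N.Arrivals T) → Choice α → Choice α)
    (r : Choice α) (prio : ℕ → Packet α → ℕ) (A : ℕ → Prop)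
    (hA : ∀ t, A t → N.IsCore ε T t) :
    ∑ i : Packet α, (if A i.slot then N.weight i.type * gain θ r i else 0) ≤
      reward (selection ε init α r) prio := by
  refine Finset.sum_le_sum fun i _ => ?_
  have hw := N.weight_nonneg i.type
  split_ifs with h1 h2 h2
  · have := gain_le hθ init r prio i (hA _ h1)
    rw [if_pos h2] at this
    nlinarith
  · have := gain_le hθ init r prio i (hA _ h1)
    rw [if_neg h2] at this
    nlinarith
  · exact hw
  · exact le_rfl

theorem reward_nonneg (c : Choice α) (prio : ℕ → Packet α → ℕ) : 0 ≤ reward c prio :=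
  Finset.sum_nonneg fun i _ => by
    split_ifs
    exacts [N.weight_nonneg _, le_rfl]

theorem prod_packet (h : Fin T × Fin N.J → ℝ) :
    ∏ i : Packet α, h i.1 = ∏ q, h q ^ α q.1 q.2 := by
  rw [Fintype.prod_sigma]
  simp

theorem sum_packet (h : Fin T × Fin N.J → ℝ) :
    ∑ i : Packet α, h i.1 = ∑ q, (α q.1 q.2 : ℝ) * h q := by
  rw [Fintype.sum_sigma]
  simp

end Pathwise

/-! ### Averaging over the link choices, given the arrivals -/

section Conditional

variable {V : Type u} [Fintype V] {N : Network V} {T : ℕ} {ε κ ζ : ℝ}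
  {solve : (Fin N.J → ℝ) → ℝ → N.Fwd}

theorem estimate_nonneg {V : Type u} {N : Network V} {T : ℕ} {ε : ℝ} (α : N.Arrivals T) (φ : ℕ) (j : Fin N.J) : 0 ≤ estimate ε α φ j := by
  refine div_nonneg (Finset.sum_nonneg fun t _ => ?_) (Nat.cast_nonneg _)
  split_ifs <;> positivity

theorem phaseFwd_feasible (hsolve : N.IsLPSolver ε solve) (α : N.Arrivals T) (φ : ℕ) :
    N.LPFeasible (estimate ε α φ) ε (N.shrink ε T κ ζ φ) (phaseFwd ε κ ζ solve α φ) :=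
  (hsolve _ _ (estimate_nonneg α φ) (le_max_left _ _)).1

theorem choiceProb_nonneg (hsolve : N.IsLPSolver ε solve) (α : N.Arrivals T) (i : Packet α)
    (o : Option (N.Walk i.type)) : 0 ≤ choiceProb ε κ ζ solve α i o := by
  unfold choiceProb
  split_ifs
  exacts [zero_le_one, le_rfl, (phaseFwd_feasible hsolve α _).walkProb_nonneg _ o]

theorem sum_choiceProb (hsolve : N.IsLPSolver ε solve) (α : N.Arrivals T) (i : Packet α) :
    ∑ o, choiceProb ε κ ζ solve α i o = 1 := by
  unfold choiceProb
  split_ifs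
  · simp
  · exact (phaseFwd_feasible hsolve α _).sum_walkProb _

theorem dlpfReward_eq_prodExp (init : (α : N.Arrivals T) → Choice α → Choice α)
    (prio : (α : N.Arrivals T) → Choice α → ℕ → Packet α → ℕ) (α : N.Arrivals T) :
    dlpfReward ε κ ζ solve init prio α =
      prodExp (fun _ => Finset.univ) (fun i => choiceProb ε κ ζ solve α i)
        (fun r => reward (selection ε init α r) (prio α r)) := by
  refine Finset.sum_congr ?_ fun _ _ => rfl
  ext
  simp

theorem dlpfReward_nonneg (hsolve : N.IsLPSolver ε solve)
    (init : (α : N.Arrivals T) → Choice α → Choice α)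
    (prio : (α : N.Arrivals T) → Choice α → ℕ → Packet α → ℕ) (α : N.Arrivals T) :
    0 ≤ dlpfReward ε κ ζ solve init prio α :=
  Finset.sum_nonneg fun _ _ => mul_nonneg
    (Finset.prod_nonneg fun i _ => choiceProb_nonneg hsolve α i _) (reward_nonneg _ _)

theorem sum_choiceProb_uses (hsolve : N.IsLPSolver ε solve) (α : N.Arrivals T) {t : ℕ}
    (ht : N.IsCore ε T t) {s : ℕ} (hs1 : t ≤ s) (hs2 : s ≤ t + N.dmax) {ℓ : V × V}
    (hℓ : N.Ext ℓ) (i : Packet α) :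
    ∑ o, choiceProb ε κ ζ solve α i o *
      (if ∃ w, o = some w ∧ w.UsesAt i.slot s ℓ then 1 else 0) =
      useProb (phaseFwd ε κ ζ solve α (N.phaseOf ε T t)) i.type i.slot s ℓ := by
  have hd := N.deadline_le_dmax i.type
  by_cases h : i.slot ≤ s ∧ s ≤ i.slot + N.deadline i.type
  · have hp := ht.2 i.slot (by omega) (by omega)
    simp only [choiceProb, hp, ht.1, if_false]
    exact (phaseFwd_feasible hsolve α _).sum_walkProb_uses _ _ _ _ hℓ
  · rw [useProb, if_neg h]
    refine Finset.sum_eq_zero fun o _ => ?_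
    rw [if_neg, mul_zero]
    rintro ⟨w, -, τ, rfl, -⟩
    have := τ.2
    omega

/-- The factor that a packet of type `q.2` arriving in slot `q.1` contributes to the exponential
moment of the number of packets that select `ℓ` for slot `s`. -/
def momentFactor (ε : ℝ) (f : N.Fwd) (s : ℕ) (ℓ : V × V) (q : Fin T × Fin N.J) : ℝ :=
  1 + ε * useProb f q.2 q.1 s ℓ

theorem one_le_momentFactor {r : Fin N.J → ℝ} {ε' η : ℝ} {f : N.Fwd}
    (hf : N.LPFeasible r ε' η f) (hε : 0 ≤ ε) (s : ℕ) {ℓ : V × V} (hℓ : N.Ext ℓ)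
    (q : Fin T × Fin N.J) : 1 ≤ momentFactor ε f s ℓ q := by
  have := hf.useProb_nonneg q.2 q.1 s ℓ hℓ
  unfold momentFactor
  nlinarith

/-- The penalty is a product over packets, hence so is its expectation: packet `i` contributes its
probability of selecting `ℓ`, every other packet contributes its `momentFactor`. The product over
the others is the full product divided by the factor of `i`. -/
theorem prodExp_penalty (hsolve : N.IsLPSolver ε solve) (hε : 0 < ε) (α : N.Arrivals T)
    (i : Packet α) (hi : N.IsCore ε T i.slot) {s : ℕ} (hs1 : i.slot ≤ s)
    (hs2 : s ≤ i.slot + N.dmax) {ℓ : V × V} (hℓ : N.Ext ℓ) :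
    prodExp (fun _ => Finset.univ) (fun i => choiceProb ε κ ζ solve α i)
      (fun r => penalty (1 + ε) r i s ℓ) =
    useProb (phaseFwd ε κ ζ solve α (N.phaseOf ε T i.slot)) i.type i.slot s ℓ /
      (1 + ε) ^ N.cap ℓ *
      ((momentFactor ε (phaseFwd ε κ ζ solve α (N.phaseOf ε T i.slot)) s ℓ i.1)⁻¹ *
      ∏ q, momentFactor ε (phaseFwd ε κ ζ solve α (N.phaseOf ε T i.slot)) s ℓ q ^ α q.1 q.2) := by
  set f := phaseFwd ε κ ζ solve α (N.phaseOf ε T i.slot) with hf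
  set sel : (i' : Packet α) → Option (N.Walk i'.type) → Prop :=
    fun i' o => ∃ w, o = some w ∧ w.UsesAt i'.slot s ℓ with hsel
  have hX : ∀ q, 1 ≤ momentFactor (T := T) ε f s ℓ q := fun q =>
    one_le_momentFactor (phaseFwd_feasible hsolve α _) hε.le s hℓ q
  have hX0 : momentFactor ε f s ℓ i.1 ≠ 0 := (zero_lt_one.trans_le (hX _)).ne'
  have h1 : ∀ r : Choice α, penalty (1 + ε) r i s ℓ = ((1 + ε) ^ N.cap ℓ)⁻¹ *
      ∏ i', (if i' = i then (if sel i' (r i') then 1 else 0)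
        else if sel i' (r i') then 1 + ε else 1) := by
    intro r
    have h2 : ∀ i', Selects r s i' ℓ ↔ sel i' (r i') := fun i' => Iff.rfl
    rw [penalty, Finset.prod_eq_mul_prod_sdiff_singleton_of_mem (Finset.mem_univ i), if_pos rfl]
    simp only [h2]
    split_ifs with h3
    · rw [div_eq_inv_mul, one_mul]
      congr 1
      have h4 : ∀ i' ∈ Finset.univ \ {i}, (if i' = i then (if sel i' (r i') then 1 else 0)
        else if sel i' (r i') then 1 + ε else 1) = if sel i' (r i') then 1 + ε else 1 := by
        intro i' hi'
        rw [if_neg (by simpa using hi')]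
      rw [Finset.prod_congr rfl h4, ← Finset.prod_filter, Finset.prod_const]
      congr 2
      ext i'
      simp
    · simp
  have h5 : ∀ i', ∑ o, choiceProb ε κ ζ solve α i' o * (if i' = i then (if sel i' o then 1 else 0)
        else if sel i' o then 1 + ε else 1) =
      if i' = i then useProb f i.type i.slot s ℓ else momentFactor ε f s ℓ i'.1 := by
    intro i'
    have h6 : ∑ o, choiceProb ε κ ζ solve α i' o * (if sel i' o then 1 else 0) =
      useProb f i'.type i'.slot s ℓ := sum_choiceProb_uses hsolve α hi hs1 hs2 hℓ i'
    split_ifs with h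
    · rw [h6, h]
    · have h7 : ∀ o, choiceProb ε κ ζ solve α i' o * (if sel i' o then 1 + ε else 1) =
          choiceProb ε κ ζ solve α i' o +
          ε * (choiceProb ε κ ζ solve α i' o * (if sel i' o then 1 else 0)) := by
        intro o
        split_ifs <;> ring
      simp only [h7]
      rw [Finset.sum_add_distrib, ← Finset.mul_sum, h6, sum_choiceProb hsolve, momentFactor]
  simp only [h1]
  rw [prodExp_const_mul, prodExp_prod (S := fun _ => Finset.univ) (fun i' o =>
    if i' = i then (if sel i' o then 1 else 0) else if sel i' o then 1 + ε else 1)]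
  simp only [h5]
  rw [← prod_packet, Finset.prod_eq_mul_prod_sdiff_singleton_of_mem (Finset.mem_univ i), if_pos rfl,
    Finset.prod_eq_mul_prod_sdiff_singleton_of_mem (f := fun i' : Packet α => momentFactor ε f s ℓ i'.1)
    (Finset.mem_univ i)]
  have h8 : ∀ i' ∈ Finset.univ \ {i}, (if i' = i then useProb f i.type i.slot s ℓ else
      momentFactor ε f s ℓ i'.1) = momentFactor ε f s ℓ i'.1 := by
    intro i' hi'
    rw [if_neg (by simpa using hi')]
  rw [Finset.prod_congr rfl h8]
  field_simp

/-- The conditional expectation, given the arrivals, of the lower bound `gain` for the packets of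
type `q.2` that arrive in slot `q.1`. -/
def slotGain (ε : ℝ) (f : N.Fwd) (α : N.Arrivals T) (q : Fin T × Fin N.J) : ℝ :=
  N.weight q.2 * (∑ ℓ ∈ N.outLinks (N.src q.2), f q.2 ℓ 0 -
    ∑ τ : Fin (N.deadline q.2 + 1), ∑ ℓ ∈ N.links, f q.2 ℓ τ / (1 + ε) ^ N.cap ℓ *
      ((momentFactor ε f (q.1 + τ) ℓ q)⁻¹ * ∏ q', momentFactor ε f (q.1 + τ) ℓ q' ^ α q'.1 q'.2))

theorem sum_slotGain_le_dlpfReward (hsolve : N.IsLPSolver ε solve) (hε : 0 < ε)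
    (init : (α : N.Arrivals T) → Choice α → Choice α)
    (prio : (α : N.Arrivals T) → Choice α → ℕ → Packet α → ℕ) (α : N.Arrivals T) (A : ℕ → Prop)
    (hA : ∀ t, A t → N.IsCore ε T t) :
    ∑ q : Fin T × Fin N.J, (if A q.1 then (α q.1 q.2 : ℝ) *
      slotGain ε (phaseFwd ε κ ζ solve α (N.phaseOf ε T q.1)) α q else 0) ≤
      dlpfReward ε κ ζ solve init prio α := by
  rw [dlpfReward_eq_prodExp]
  refine le_trans ?_ (prodExp_mono (S := fun _ => Finset.univ)
    (fun i o _ => choiceProb_nonneg hsolve α i o)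
    fun r _ => sum_gain_le_reward (θ := 1 + ε) (by linarith) init r (prio α r) A hA)
  rw [prodExp_sum]
  have h1 : ∑ q : Fin T × Fin N.J, (if A q.1 then (α q.1 q.2 : ℝ) *
      slotGain ε (phaseFwd ε κ ζ solve α (N.phaseOf ε T q.1)) α q else 0) =
      ∑ i : Packet α, (if A i.slot then
      slotGain ε (phaseFwd ε κ ζ solve α (N.phaseOf ε T i.slot)) α i.1 else 0) := by
    have := sum_packet (α := α) fun q => (if A q.1 then
      slotGain ε (phaseFwd ε κ ζ solve α (N.phaseOf ε T q.1)) α q else 0)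
    rw [this]
    simp only [mul_ite, mul_zero]
  rw [h1]
  refine le_of_eq (Finset.sum_congr rfl fun i _ => ?_)
  split_ifs with hi
  · have hd := N.deadline_le_dmax i.type
    rw [prodExp_const_mul]
    unfold gain
    rw [prodExp_sub, prodExp_sum, slotGain]
    congr 2
    · rw [prodExp_eval (S := fun _ => Finset.univ) (sum_choiceProb hsolve α) i
        (fun o => if ∃ w, o = some w ∧ w.Arrives then 1 else 0)]
      simp only [choiceProb, if_neg (hA _ hi).1]
      exact ((phaseFwd_feasible hsolve α _).sum_walkProb_arrives _).symm
    · refine Finset.sum_congr rfl fun τ _ => ?_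
      rw [prodExp_sum]
      refine Finset.sum_congr rfl fun ℓ hℓ => ?_
      have hτ : (τ : ℕ) < N.deadline i.type + 1 := τ.2
      change _ = prodExp _ _ fun r => penalty (1 + ε) r i (i.slot + τ) ℓ
      rw [prodExp_penalty hsolve hε α i (hA _ hi) (Nat.le_add_right _ _) (by omega) (Or.inl hℓ),
        useProb, if_pos ⟨Nat.le_add_right _ _, by omega⟩, Nat.add_sub_cancel_left]
  · simp [prodExp]

end Conditional
end Network

/-! ### The Chernoff bound, averaged over the arrivals -/

open MeasureTheory ProbabilityTheory in
theorem binExp_indicator {Q : Type*} [Fintype Q] (n : Q → ℕ)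
    {Ω : Type*} [MeasurableSpace Ω] {P : Measure Ω}
    [IsProbabilityMeasure P] {X : Q → Ω → ℕ} {r : Q → unitInterval}
    (hX : ∀ q, HasLaw (X q) (binomial (n q) (r q)) P) (hi : iIndepFun X P)
    (B : (Q → ℕ) → Prop) :
    binExp n (fun q => (r q : ℝ)) (fun x => if B x then 1 else 0) =
      P.real {ω | B fun q => X q ω} := by
  rw [← integral_eq_binExp n hX hi]
  have hm : AEMeasurable (fun ω q => X q ω) P :=
    aemeasurable_pi_iff.2 fun q => (hX q).aemeasurable
  have hs : NullMeasurableSet {ω | B fun q => X q ω} P :=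
    hm.nullMeasurable (Set.to_countable {x | B x}).measurableSet
  have := integral_indicator₀ (f := fun _ => (1 : ℝ)) hs
  rw [setIntegral_const, smul_eq_mul, mul_one] at this
  rw [← this]
  refine integral_congr_ae (Filter.Eventually.of_forall fun ω => ?_)
  simp [Set.indicator_apply]

/-- The first two terms of the power series, all of whose terms are nonnegative. -/
theorem add_sq_div_two_le_neg_log {x : ℝ} (h0 : 0 ≤ x) (h1 : x < 1) :
    x + x ^ 2 / 2 ≤ -Real.log (1 - x) := by
  have h := Real.hasSum_pow_div_log_of_abs_lt_one (x := x) (by rwa [abs_of_nonneg h0])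
  have h2 := sum_le_hasSum (Finset.range 2) (fun i _ => by positivity) h
  norm_num [Finset.sum_range_succ] at h2
  exact h2

/-- With x = ε/(1+ε) one has log(1+ε) = -log(1-x) ≥ x + x²/2. The linear terms cancel in the
exponent and leave at most -Cx²/2, which the hypothesis on `C` puts below -log(L/ε). -/
theorem chernoff_bound {ε : ℝ} (hε : 0 < ε) {L C : ℕ} (hL : 0 < L)
    (hC : 2 * ((1 + ε) / ε) ^ 2 * Real.log (L / ε) ≤ C) :
    Real.exp (ε * (C / (1 + ε))) / (1 + ε) ^ C ≤ ε / L := by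
  have hL' : (0 : ℝ) < L := Nat.cast_pos.2 hL
  have h1 : 0 < 1 + ε := by linarith
  have h2 := add_sq_div_two_le_neg_log (x := ε / (1 + ε)) (by positivity)
    ((div_lt_one h1).2 (by linarith))
  have h3 : 1 - ε / (1 + ε) = (1 + ε)⁻¹ := by field_simp; ring
  rw [h3, Real.log_inv, neg_neg] at h2
  have h4 : Real.log (L / ε) ≤ C * ((ε / (1 + ε)) ^ 2 / 2) := by
    have := mul_le_mul_of_nonneg_right hC (by positivity : 0 ≤ (ε / (1 + ε)) ^ 2 / 2)
    refine le_trans (le_of_eq ?_) this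
    field_simp
  have h5 : (1 + ε) ^ C = Real.exp (C * Real.log (1 + ε)) := by
    rw [Real.exp_nat_mul, Real.exp_log h1]
  have h6 : ε / L = Real.exp (-Real.log (L / ε)) := by
    rw [← Real.log_inv, Real.exp_log (by positivity), inv_div]
  rw [h5, h6, ← Real.exp_sub]
  apply Real.exp_le_exp.2
  have h7 := mul_le_mul_of_nonneg_left h2 (Nat.cast_nonneg C : (0 : ℝ) ≤ C)
  have h8 : ε * (C / (1 + ε)) = C * (ε / (1 + ε)) := by ring
  rw [h8]
  linarith

namespace Network

section Expected

variable {V : Type u} {N : Network V} {T : ℕ}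

theorem rate_pos (N : Network V) (j : Fin N.J) : 0 < N.rate j :=
  mul_pos (Nat.cast_pos.2 (N.trials_pos j)) (N.prob_pos j)

/-- The expectation over the arrivals. -/
abbrev arrExp (N : Network V) (T : ℕ) (F : (Fin T × Fin N.J → ℕ) → ℝ) : ℝ :=
  binExp (fun q : Fin T × Fin N.J => N.trials q.2) (fun q => (N.prob q.2 : ℝ)) F

/-- The arrival sequence as a function of slot and type. -/
abbrev toArr (x : Fin T × Fin N.J → ℕ) : N.Arrivals T := fun t j => x (t, j)

theorem arrWeight_nonneg (N : Network V) (T : ℕ) (q : Fin T × Fin N.J) :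
    ∀ m ∈ Finset.range (N.trials q.2 + 1), 0 ≤ binomialWeight (N.trials q.2) (N.prob q.2 : ℝ) m :=
  fun m _ => binomialWeight_nonneg _ (N.prob q.2).2.1 (N.prob q.2).2.2 m

theorem arrExp_apply (N : Network V) (T : ℕ) (q : Fin T × Fin N.J) :
    N.arrExp T (fun x => (x q : ℝ)) = N.rate q.2 := by
  have h := prodExp_eval (S := fun q : Fin T × Fin N.J => Finset.range (N.trials q.2 + 1))
    (b := fun q => binomialWeight (N.trials q.2) (N.prob q.2 : ℝ))
    (fun q => sum_binomialWeight _ _) q (fun m => (m : ℝ))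
  exact h.trans (sum_binomialWeight_mul_id _ _)

theorem estimate_congr {ε : ℝ} {α β : N.Arrivals T} {φ : ℕ}
    (h : ∀ t : Fin T, (t : ℕ) < N.phaseStart ε T φ → α t = β t) :
    estimate ε α φ = estimate ε β φ := by
  funext j
  unfold estimate
  congr 1
  refine Finset.sum_congr rfl fun t _ => ?_
  split_ifs with ht
  · rw [h t ht]
  · rfl

variable [Fintype V]

/-- A packet present in slot `s` at age τ arrived in slot s-τ, so the sum over arrival slots is a
sum over distinct ages. Ages whose arrival slot lies outside the horizon are missing, hence only an
inequality. -/
theorem sum_rate_mul_useProb_le {r : Fin N.J → ℝ} {ε η : ℝ} {f : N.Fwd}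
    (hf : N.LPFeasible r ε η f) (s : ℕ) {ℓ : V × V} (hℓ : N.Ext ℓ) :
    ∑ q : Fin T × Fin N.J, N.rate q.2 * useProb f q.2 q.1 s ℓ ≤
      ∑ j, ∑ τ ∈ Finset.range (N.deadline j + 1), N.rate j * f j ℓ τ := by
  rw [Fintype.sum_prod_type_right]
  refine Finset.sum_le_sum fun j _ => ?_
  have hd := N.deadline_le_dmax j
  simp only [useProb, mul_ite, mul_zero]
  rw [← Finset.sum_filter]
  refine (Finset.sum_image (f := fun τ => N.rate j * f j ℓ τ) (g := fun t : Fin T => s - t)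
    ?_).symm.trans_le (Finset.sum_le_sum_of_subset_of_nonneg ?_ ?_)
  · intro a ha b hb hab
    simp only [Finset.coe_filter, Finset.mem_univ, true_and, Set.mem_ofPred_eq] at ha hb hab
    ext
    omega
  · intro τ hτ
    simp only [Finset.mem_image, Finset.mem_filter, Finset.mem_univ, true_and] at hτ
    obtain ⟨t, ht, rfl⟩ := hτ
    rw [Finset.mem_range]
    omega
  · intro τ hτ _
    rw [Finset.mem_range] at hτ
    exact mul_nonneg (N.rate_pos j).le (hf.nonneg j ℓ τ hℓ (by omega))

/-- The expected reward from the packets of type `q.2` arriving in slot `q.1`, given the arrivals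
in the slots outside the phase of `q.1`. -/
theorem le_arrExp_slotGain {r : Fin N.J → ℝ} {ε η : ℝ} {f : N.Fwd}
    (hf : N.LPFeasible r ε η f) (hε : 0 < ε)
    (hcap : ∀ ℓ ∈ N.links, 2 * ((1 + ε) / ε) ^ 2 * Real.log (N.maxLen / ε) ≤ N.cap ℓ)
    (hload : ∀ ℓ ∈ N.links, ∑ j, ∑ τ ∈ Finset.range (N.deadline j + 1), N.rate j * f j ℓ τ ≤
      N.cap ℓ / (1 + ε)) (x : Fin T × Fin N.J → ℕ) (U : Fin T × Fin N.J → Prop)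
    (q : Fin T × Fin N.J) (hqU : ¬ U q) (hU : ∀ q', U q' → (q'.1 : ℕ) + N.dmax < q.1) :
    N.weight q.2 * N.rate q.2 * ((1 - ε) * ∑ ℓ ∈ N.outLinks (N.src q.2), f q.2 ℓ 0) ≤
      N.arrExp T (fun y => ((if U q then x q else y q : ℕ) : ℝ) *
        slotGain ε f (toArr fun q => if U q then x q else y q) q) := by
  have hd := N.deadline_le_dmax
  have hX : ∀ s, ∀ ℓ ∈ N.links, ∀ q', 1 ≤ momentFactor (T := T) ε f s ℓ q' := fun s ℓ hℓ q' =>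
    one_le_momentFactor hf hε.le s (Or.inl hℓ) q'
  -- Packets from the fixed coordinates have expired by slot `q.1`, so their factors are 1 and the
  -- penalties involve fresh arrivals only.
  have hX1 : ∀ s, (q.1 : ℕ) ≤ s → ∀ ℓ q', U q' → momentFactor (T := T) ε f s ℓ q' = 1 := by
    intro s hs ℓ q' hq'
    have h1 := hU q' hq'
    have h2 := hd q'.2
    rw [momentFactor, useProb, if_neg (by omega), mul_zero, add_zero]
  set S0 := ∑ ℓ ∈ N.outLinks (N.src q.2), f q.2 ℓ 0 with hS0
  set G : Fin (N.deadline q.2 + 1) → V × V → (Fin T × Fin N.J → ℕ) → ℝ := fun τ ℓ y =>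
    (y q : ℝ) * ((momentFactor ε f (q.1 + τ) ℓ q)⁻¹ * ∏ q', momentFactor ε f (q.1 + τ) ℓ q' ^ y q')
  have h1 : N.arrExp T (fun y => ((if U q then x q else y q : ℕ) : ℝ) *
        slotGain ε f (toArr fun q => if U q then x q else y q) q) =
      N.arrExp T (fun y => N.weight q.2 * (S0 * y q -
        ∑ τ : Fin (N.deadline q.2 + 1), ∑ ℓ ∈ N.links, f q.2 ℓ τ / (1 + ε) ^ N.cap ℓ *
          G τ ℓ y)) := by
    refine prodExp_congr fun y _ => ?_
    have h0 : ∑ τ : Fin (N.deadline q.2 + 1), ∑ ℓ ∈ N.links, f q.2 ℓ τ / (1 + ε) ^ N.cap ℓ *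
        G τ ℓ y = (y q : ℝ) * ∑ τ : Fin (N.deadline q.2 + 1), ∑ ℓ ∈ N.links,
        f q.2 ℓ τ / (1 + ε) ^ N.cap ℓ * ((momentFactor ε f (q.1 + τ) ℓ q)⁻¹ *
        ∏ q', momentFactor ε f (q.1 + τ) ℓ q' ^ (if U q' then x q' else y q')) := by
      simp only [Finset.mul_sum]
      refine Finset.sum_congr rfl fun τ _ => Finset.sum_congr rfl fun ℓ _ => ?_
      rw [mul_left_comm]
      congr 3
      refine Finset.prod_congr rfl fun q' _ => ?_
      by_cases h : U q'
      · rw [hX1 _ (Nat.le_add_right _ _) ℓ q' h, one_pow, one_pow]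
      · rw [if_neg h]
    rw [h0, if_neg hqU, slotGain, ← hS0]
    ring
  have h2 : ∀ τ : Fin (N.deadline q.2 + 1), ∀ ℓ ∈ N.links, 0 < N.maxLen →
      N.arrExp T (G τ ℓ) / (1 + ε) ^ N.cap ℓ ≤ N.rate q.2 * (ε / N.maxLen) := by
    intro τ ℓ hℓ hL
    have h3 := binExp_size_biased_le (fun q : Fin T × Fin N.J => N.trials q.2)
      (fun q => (N.prob q.2 : ℝ)) (fun q => (N.prob q.2).2.1) (fun q => (N.prob q.2).2.2)
      (momentFactor ε f (q.1 + τ) ℓ) (hX _ ℓ hℓ) q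
    have h4 : ∑ q' : Fin T × Fin N.J, (N.trials q'.2 : ℝ) * (N.prob q'.2 : ℝ) *
        (momentFactor ε f (q.1 + τ) ℓ q' - 1) ≤ ε * (N.cap ℓ / (1 + ε)) := by
      refine le_trans (le_of_eq ?_) (mul_le_mul_of_nonneg_left
        ((sum_rate_mul_useProb_le (T := T) hf (q.1 + τ) (Or.inl hℓ)).trans (hload ℓ hℓ)) hε.le)
      rw [Finset.mul_sum]
      refine Finset.sum_congr rfl fun q' _ => ?_
      rw [momentFactor, rate]
      ring
    have h5 : N.arrExp T (G τ ℓ) ≤ N.rate q.2 * Real.exp (ε * (N.cap ℓ / (1 + ε))) :=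
      h3.trans (mul_le_mul_of_nonneg_left (Real.exp_le_exp.2 h4) (N.rate_pos q.2).le)
    calc _ ≤ N.rate q.2 * Real.exp (ε * (N.cap ℓ / (1 + ε))) / (1 + ε) ^ N.cap ℓ := by
          gcongr
      _ = N.rate q.2 * (Real.exp (ε * (N.cap ℓ / (1 + ε))) / (1 + ε) ^ N.cap ℓ) := by ring
      _ ≤ _ := mul_le_mul_of_nonneg_left (chernoff_bound hε hL (hcap ℓ hℓ)) (N.rate_pos q.2).le
  have h6 : ∑ τ : Fin (N.deadline q.2 + 1), ∑ ℓ ∈ N.links, f q.2 ℓ τ / (1 + ε) ^ N.cap ℓ *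
      N.arrExp T (G τ ℓ) ≤ N.rate q.2 * (ε * S0) := by
    have hS := hf.sum_links_le q.2
    have hnn : ∀ τ : Fin (N.deadline q.2 + 1), ∀ ℓ ∈ N.links, 0 ≤ f q.2 ℓ τ := fun τ ℓ hℓ =>
      hf.nonneg _ _ _ (Or.inl hℓ) (by have := τ.2; have := hd q.2; omega)
    have hS0' : 0 ≤ S0 := hf.out_nonneg q.2 (Nat.zero_le _) _
    -- If `maxLen` is 0 then ε/L has no meaning, but then no network link carries flow and every
    -- penalty vanishes.
    rcases Nat.eq_zero_or_pos N.maxLen with hL | hL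
    · rw [hL, Nat.cast_zero, zero_mul] at hS
      have hz : ∀ τ : Fin (N.deadline q.2 + 1), ∀ ℓ ∈ N.links, f q.2 ℓ τ = 0 := by
        intro τ ℓ hℓ
        refine le_antisymm ?_ (hnn τ ℓ hℓ)
        refine le_trans ?_ hS
        refine le_trans ?_ (Finset.single_le_sum (f := fun τ : Fin (N.deadline q.2 + 1) =>
          ∑ ℓ ∈ N.links, f q.2 ℓ τ) (fun τ _ => Finset.sum_nonneg fun ℓ hℓ => hnn τ ℓ hℓ)
          (Finset.mem_univ τ))
        exact Finset.single_le_sum (f := fun ℓ => f q.2 ℓ τ) (fun ℓ hℓ => hnn τ ℓ hℓ) hℓ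
      refine le_trans (le_of_eq (Finset.sum_eq_zero fun τ _ => Finset.sum_eq_zero fun ℓ hℓ => ?_))
        (mul_nonneg (N.rate_pos _).le (mul_nonneg hε.le hS0'))
      rw [hz τ ℓ hℓ, zero_div, zero_mul]
    · have hL' : (0 : ℝ) < N.maxLen := Nat.cast_pos.2 hL
      calc _ ≤ ∑ τ : Fin (N.deadline q.2 + 1), ∑ ℓ ∈ N.links,
            N.rate q.2 * (ε / N.maxLen) * f q.2 ℓ τ := by
            refine Finset.sum_le_sum fun τ _ => Finset.sum_le_sum fun ℓ hℓ => ?_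
            have := mul_le_mul_of_nonneg_right (h2 τ ℓ hℓ hL) (hnn τ ℓ hℓ)
            refine le_trans (le_of_eq ?_) this
            ring
        _ = N.rate q.2 * (ε / N.maxLen) * ∑ τ : Fin (N.deadline q.2 + 1),
            ∑ ℓ ∈ N.links, f q.2 ℓ τ := by simp only [Finset.mul_sum]
        _ ≤ N.rate q.2 * (ε / N.maxLen) * (N.maxLen * S0) :=
            mul_le_mul_of_nonneg_left hS (mul_nonneg (N.rate_pos _).le (by positivity))
        _ = _ := by field_simp
  have h7 : N.arrExp T (fun y => N.weight q.2 * (S0 * y q -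
        ∑ τ : Fin (N.deadline q.2 + 1), ∑ ℓ ∈ N.links, f q.2 ℓ τ / (1 + ε) ^ N.cap ℓ *
          G τ ℓ y)) = N.weight q.2 * (S0 * N.rate q.2 -
        ∑ τ : Fin (N.deadline q.2 + 1), ∑ ℓ ∈ N.links, f q.2 ℓ τ / (1 + ε) ^ N.cap ℓ *
          N.arrExp T (G τ ℓ)) := by
    rw [← arrExp_apply N T q]
    unfold arrExp binExp
    rw [prodExp_const_mul, prodExp_sub, prodExp_const_mul, prodExp_sum]
    congr 2
    refine Finset.sum_congr rfl fun τ _ => ?_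
    rw [prodExp_sum]
    exact Finset.sum_congr rfl fun ℓ _ => prodExp_const_mul _ _
  rw [h1, h7, mul_assoc]
  refine mul_le_mul_of_nonneg_left ?_ (N.weight_nonneg _)
  linarith

end Expected
end Network

namespace Network

/-! ### Phase arithmetic -/

section Phases

variable {V : Type u} (N : Network V) (ε : ℝ) (T : ℕ)

theorem phaseStart_succ {φ : ℕ} (hφ : 1 ≤ φ) :
    N.phaseStart ε T (φ + 1) = N.phaseStart ε T φ + (N.dmax + N.phaseLen ε T φ) := by
  rw [phaseStart, phaseStart, Finset.sum_Ico_succ_top hφ, add_assoc]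

theorem phaseStart_mono : Monotone (N.phaseStart ε T) := by
  intro a b h
  unfold phaseStart
  gcongr

/-- Because the lengths double, T_0 plus the earlier T_i is exactly T_φ. Thus the estimate in phase
φ uses at least T_φ samples, which the confidence radius takes for granted. -/
theorem phaseLen_le_phaseStart {φ : ℕ} (hφ : 1 ≤ φ) : N.phaseLen ε T φ ≤ N.phaseStart ε T φ := by
  induction φ, hφ using Nat.le_induction with
  | base => simp [phaseLen, phaseStart]
  | succ φ hφ ih =>
    rw [N.phaseStart_succ ε T hφ]
    have : N.phaseLen ε T (φ + 1) = 2 * N.phaseLen ε T φ := by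
      obtain ⟨k, rfl⟩ : ∃ k, φ = k + 1 := ⟨φ - 1, by omega⟩
      simp only [phaseLen, Nat.add_sub_cancel, pow_succ]
      ring
    omega

theorem phaseOf_le (t : ℕ) : N.phaseOf ε T t ≤ numPhases ε := by
  unfold phaseOf
  refine (Finset.card_filter_le _ _).trans ?_
  simp

/-- `phaseOf` counts the starts not after `t`; starts are monotone, so the phases counted form an
initial segment. -/
theorem phaseStart_le_iff {φ : ℕ} (h1 : 1 ≤ φ) (h2 : φ ≤ numPhases ε) (t : ℕ) :
    N.phaseStart ε T φ ≤ t ↔ φ ≤ N.phaseOf ε T t := by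
  constructor
  · intro h
    have hsub : Finset.Icc 1 φ ⊆
        (Finset.Icc 1 (numPhases ε)).filter fun φ => N.phaseStart ε T φ ≤ t := by
      intro ψ hψ
      rw [Finset.mem_Icc] at hψ
      rw [Finset.mem_filter, Finset.mem_Icc]
      exact ⟨⟨hψ.1, hψ.2.trans h2⟩, (N.phaseStart_mono ε T hψ.2).trans h⟩
    have h3 := Finset.card_le_card hsub
    rw [Nat.card_Icc, Nat.add_sub_cancel] at h3
    exact h3
  · intro h
    by_contra h3
    have hsub : ((Finset.Icc 1 (numPhases ε)).filter fun φ => N.phaseStart ε T φ ≤ t) ⊆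
        Finset.Icc 1 (φ - 1) := by
      intro ψ hψ
      rw [Finset.mem_filter, Finset.mem_Icc] at hψ
      rw [Finset.mem_Icc]
      refine ⟨hψ.1.1, ?_⟩
      by_contra h4
      exact h3 ((N.phaseStart_mono ε T (by omega)).trans hψ.2)
    have h5 := Finset.card_le_card hsub
    rw [Nat.card_Icc] at h5
    have h6 : N.phaseOf ε T t ≤ φ - 1 + 1 - 1 := h5
    omega

theorem phaseStart_phaseOf_le {t : ℕ} (h : N.phaseOf ε T t ≠ 0) :
    N.phaseStart ε T (N.phaseOf ε T t) ≤ t :=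
  (N.phaseStart_le_iff ε T (Nat.one_le_iff_ne_zero.2 h) (N.phaseOf_le ε T t) t).2 le_rfl

end Phases

/-! ### Rates, confidence radii, and stability of the LP -/

section Rates

variable {V : Type u} (N : Network V)

theorem rateMin_le (j : Fin N.J) : N.rateMin ≤ N.rate j :=
  ciInf_le (Set.finite_range _).bddBelow j

theorem rateMin_pos : 0 < N.rateMin := by
  have : Nonempty (Fin N.J) := ⟨⟨0, N.J_pos⟩⟩
  obtain ⟨j, hj⟩ := exists_eq_ciInf_of_finite (f := N.rate)
  rw [rateMin, ← hj]
  exact N.rate_pos j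

theorem trials_le_amax (j : Fin N.J) : N.trials j ≤ N.amax :=
  Finset.le_sup (f := N.trials) (Finset.mem_univ j)

theorem rateMin_le_amax : N.rateMin ≤ N.amax := by
  have h1 := N.rateMin_le ⟨0, N.J_pos⟩
  have h2 : (N.trials ⟨0, N.J_pos⟩ : ℝ) ≤ N.amax := by exact_mod_cast N.trials_le_amax _
  have h3 := (N.prob ⟨0, N.J_pos⟩).2.2
  have h4 : N.rate ⟨0, N.J_pos⟩ ≤ N.trials ⟨0, N.J_pos⟩ :=
    mul_le_of_le_one_right (Nat.cast_nonneg _) h3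
  linarith

/-- The half-width of the confidence interval in phase `φ`, relative to the rate. -/
def radius (ε : ℝ) (T : ℕ) (κ : ℝ) (φ : ℕ) : ℝ :=
  √(κ * Real.log (2 * N.J / ε) / N.phaseLen ε T φ)

theorem radius_nonneg (ε : ℝ) (T : ℕ) (κ : ℝ) (φ : ℕ) : 0 ≤ N.radius ε T κ φ := Real.sqrt_nonneg _

/-- All estimates of the rates in phase `φ` are accurate up to a factor `1 ± δ`. -/
def Accurate {T : ℕ} (ε : ℝ) (α : N.Arrivals T) (φ : ℕ) (δ : ℝ) : Prop :=
  ∀ j, |estimate ε α φ j - N.rate j| ≤ δ * N.rate j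

end Rates

section Perturbation

variable {V : Type u} [Fintype V] {N : Network V} {ε δ : ℝ} {r : Fin N.J → ℝ} {f : N.Fwd}

theorem LPFeasible.smul {r' : Fin N.J → ℝ} {η η' : ℝ} (hf : N.LPFeasible r ε η f) {c : ℝ}
    (hc0 : 0 ≤ c) (hc1 : c ≤ 1)
    (hcap : ∀ ℓ ∈ N.links, ∑ j, ∑ τ ∈ Finset.range (N.deadline j + 1), r' j * (c * f j ℓ τ) ≤
      η' * N.cap ℓ / (1 + ε)) :
    N.LPFeasible r' ε η' (fun j ℓ τ => c * f j ℓ τ) where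
  nonneg j ℓ τ h1 h2 := mul_nonneg hc0 (hf.nonneg j ℓ τ h1 h2)
  one_choice j := by
    rw [← Finset.mul_sum]
    exact mul_le_one₀ hc1 (hf.out_nonneg j (Nat.zero_le _) _) (hf.one_choice j)
  conserve j v τ h := by rw [← Finset.mul_sum, ← Finset.mul_sum, hf.conserve j v τ h]
  start j ℓ h1 h2 := by rw [hf.start j ℓ h1 h2, mul_zero]
  finish j ℓ h1 h2 := by rw [hf.finish j ℓ h1 h2, mul_zero]
  capacity := hcap

theorem lpObj_smul (r : Fin N.J → ℝ) (f : N.Fwd) (c : ℝ) :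
    N.lpObj r (fun j ℓ τ => c * f j ℓ τ) = c * N.lpObj r f := by
  simp only [lpObj, ← Finset.mul_sum]
  rw [Finset.mul_sum]
  exact Finset.sum_congr rfl fun j _ => by ring

theorem LPFeasible.mul_lpObj_le {r₁ r₂ : Fin N.J → ℝ} {η : ℝ} (hf : N.LPFeasible r ε η f) {c : ℝ}
    (h : ∀ j, c * r₁ j ≤ r₂ j) : c * N.lpObj r₁ f ≤ N.lpObj r₂ f := by
  rw [lpObj, lpObj, Finset.mul_sum]
  refine Finset.sum_le_sum fun j _ => ?_
  have h1 := hf.out_nonneg j (Nat.zero_le _) (N.src j)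
  have h2 := N.weight_nonneg j
  have := mul_le_mul_of_nonneg_right (mul_le_mul_of_nonneg_left (h j) h2) h1
  linarith

theorem LPFeasible.mul_load_le {r₁ r₂ : Fin N.J → ℝ} {η : ℝ} (hf : N.LPFeasible r ε η f) {c : ℝ}
    (h : ∀ j, c * r₁ j ≤ r₂ j) {ℓ : V × V} (hℓ : N.Ext ℓ) :
    c * ∑ j, ∑ τ ∈ Finset.range (N.deadline j + 1), r₁ j * f j ℓ τ ≤
      ∑ j, ∑ τ ∈ Finset.range (N.deadline j + 1), r₂ j * f j ℓ τ := by
  simp only [Finset.mul_sum, ← mul_assoc]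
  refine Finset.sum_le_sum fun j _ => Finset.sum_le_sum fun τ hτ => ?_
  have := N.deadline_le_dmax j
  rw [Finset.mem_range] at hτ
  exact mul_le_mul_of_nonneg_right (h j) (hf.nonneg j ℓ τ hℓ (by omega))

theorem LPFeasible.lpObj_nonneg {r₁ : Fin N.J → ℝ} {η : ℝ} (hf : N.LPFeasible r ε η f)
    (h : ∀ j, 0 ≤ r₁ j) : 0 ≤ N.lpObj r₁ f :=
  Finset.sum_nonneg fun j _ => mul_nonneg (mul_nonneg (N.weight_nonneg j) (h j))
    (hf.out_nonneg j (Nat.zero_le _) _)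

/-- The true rates exceed the estimates by at most the factor 1/(1-δ), exactly what the shrunken
capacities absorb. -/
theorem load_le_of_close (hδ1 : δ < 1) (hr : ∀ j, |r j - N.rate j| ≤ δ * N.rate j)
    (hf : N.LPFeasible r ε (1 - δ) f) {ℓ : V × V} (hℓ : ℓ ∈ N.links) :
    ∑ j, ∑ τ ∈ Finset.range (N.deadline j + 1), N.rate j * f j ℓ τ ≤ N.cap ℓ / (1 + ε) := by
  have h1 := hf.mul_load_le (r₁ := N.rate) (r₂ := r) (c := 1 - δ)
    (fun j => by have := (abs_le.1 (hr j)).1; linarith) (Or.inl hℓ)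
  have h2 := h1.trans (hf.capacity ℓ hℓ)
  rw [mul_div_assoc] at h2
  exact le_of_mul_le_mul_left h2 (by linarith)

/-- Scaling the true optimum by (1-δ)/(1+δ) makes it feasible for the estimated LP: 1/(1+δ) offsets
overestimated rates, 1-δ the shrunken capacities. Passing from true to estimated objective and back
costs the same two factors again. -/
theorem lpObj_ge_of_close (hδ0 : 0 ≤ δ) (hδ1 : δ < 1)
    (hr : ∀ j, |r j - N.rate j| ≤ δ * N.rate j)
    (hf : N.LPFeasible r ε (1 - δ) f) {f' : N.Fwd} (hf' : N.LPFeasible N.rate ε 1 f')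
    (hopt : ∀ g, N.LPFeasible r ε (1 - δ) g → N.lpObj r g ≤ N.lpObj r f) :
    (1 - 4 * δ) * N.lpObj N.rate f' ≤ N.lpObj N.rate f := by
  have hup : ∀ j, (1 + δ)⁻¹ * r j ≤ N.rate j := fun j => by
    rw [inv_mul_le_iff₀ (by linarith)]
    have := (abs_le.1 (hr j)).2
    linarith
  have hc0 : 0 ≤ (1 - δ) * (1 + δ)⁻¹ := mul_nonneg (by linarith) (inv_nonneg.2 (by linarith))
  have hc1 : (1 - δ) * (1 + δ)⁻¹ ≤ 1 := by
    rw [← div_eq_mul_inv]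
    exact div_le_one_of_le₀ (by linarith) (by linarith)
  have hg : N.LPFeasible r ε (1 - δ) fun j ℓ τ => ((1 - δ) * (1 + δ)⁻¹) * f' j ℓ τ := by
    refine hf'.smul hc0 hc1 fun ℓ hℓ => ?_
    have h1 := (hf'.mul_load_le hup (Or.inl hℓ)).trans (hf'.capacity ℓ hℓ)
    have h2 := mul_le_mul_of_nonneg_left h1 (by linarith : 0 ≤ 1 - δ)
    calc _ = (1 - δ) * ((1 + δ)⁻¹ * ∑ j, ∑ τ ∈ Finset.range (N.deadline j + 1),
          r j * f' j ℓ τ) := by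
          simp only [Finset.mul_sum]
          refine Finset.sum_congr rfl fun j _ => Finset.sum_congr rfl fun τ _ => by ring
      _ ≤ _ := h2
      _ = _ := by ring
  have h1 := hopt _ hg
  rw [lpObj_smul] at h1
  have h2 := hf.mul_lpObj_le (r₁ := r) (r₂ := N.rate) hup
  have h3 := hf'.mul_lpObj_le (r₁ := N.rate) (r₂ := r) (c := 1 - δ)
    (fun j => by have := (abs_le.1 (hr j)).1; linarith)
  have hV := hf'.lpObj_nonneg (fun j => (N.rate_pos j).le)
  set v := N.lpObj N.rate f'
  have h4 : ((1 - δ) * (1 + δ)⁻¹) ^ 2 * v ≤ N.lpObj N.rate f := by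
    calc _ = (1 + δ)⁻¹ * (((1 - δ) * (1 + δ)⁻¹) * ((1 - δ) * v)) := by ring
      _ ≤ (1 + δ)⁻¹ * N.lpObj r f := by
        refine mul_le_mul_of_nonneg_left (le_trans ?_ h1) (inv_nonneg.2 (by linarith))
        exact mul_le_mul_of_nonneg_left h3 hc0
      _ ≤ _ := h2
  refine le_trans (mul_le_mul_of_nonneg_right ?_ hV) h4
  -- What remains is ((1-δ)/(1+δ))² ≥ 1-4δ.
  rw [← div_eq_mul_inv, div_pow, le_div_iff₀ (by positivity)]
  nlinarith [mul_nonneg hδ0 hδ0, mul_nonneg (mul_nonneg hδ0 hδ0) hδ0]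

end Perturbation

/-! ### Probability of accurate estimates -/

section Accuracy

variable {V : Type u} {N : Network V} {T : ℕ} {ε κ : ℝ}

-- Hoeffding's inequality gives each type a failure probability at most ε/J, and the union bound
-- over the J types gives ε. Only the lower bound on `κ` matters, so both choices of `κ` in the
-- theorem are covered.
open MeasureTheory ProbabilityTheory in
theorem arrExp_accurate_ge {Ω : Type*} [MeasurableSpace Ω] {P : Measure Ω}
    [IsProbabilityMeasure P] {a : Fin T → Fin N.J → Ω → ℕ}
    (ha : ∀ t j, HasLaw (a t j) (binomial (N.trials j) (N.prob j)) P)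
    (hi : iIndepFun (fun q : Fin T × Fin N.J => a q.1 q.2) P)
    (hε : 0 < ε) (hε1 : ε < 1)
    (hκ : (N.amax : ℝ) ^ 2 / (2 * N.rateMin ^ 2) ≤ κ) {φ : ℕ} (hφ : 1 ≤ φ)
    (hpos : 0 < N.phaseLen ε T φ) (hT : N.phaseStart ε T φ ≤ T) :
    1 - ε ≤ N.arrExp T
      (fun x => if N.Accurate ε (toArr x) φ (N.radius ε T κ φ) then 1 else 0) := by
  set δ := N.radius ε T κ φ with hδ
  set m := N.phaseStart ε T φ with hm
  have hlen : N.phaseLen ε T φ ≤ m := N.phaseLen_le_phaseStart ε T hφ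
  have hm0 : (0 : ℝ) < m := Nat.cast_pos.2 (hpos.trans_le hlen)
  have hJ : (0 : ℝ) < N.J := Nat.cast_pos.2 N.J_pos
  have hJ1 : (1 : ℝ) ≤ N.J := by exact_mod_cast N.J_pos
  have hlog : 0 ≤ Real.log (2 * N.J / ε) := Real.log_nonneg (by
    rw [le_div_iff₀ hε]; linarith)
  have hκ0 : 0 ≤ κ := le_trans (by positivity) hκ
  have hlen0 : (0 : ℝ) < N.phaseLen ε T φ := Nat.cast_pos.2 hpos
  have hlen' : (N.phaseLen ε T φ : ℝ) ≤ m := by exact_mod_cast hlen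
  have hδ2 : δ ^ 2 * N.phaseLen ε T φ = κ * Real.log (2 * N.J / ε) := by
    rw [hδ, radius, Real.sq_sqrt (by positivity), div_mul_cancel₀ _ hlen0.ne']
  have hδ0 : 0 ≤ δ := N.radius_nonneg ε T κ φ
  have hbad : ∀ j, N.arrExp T
      (fun x => if δ * N.rate j ≤ |estimate ε (toArr x) φ j - N.rate j| then 1 else 0) ≤
      ε / N.J := by
    intro j
    have h1 := binExp_indicator (fun q : Fin T × Fin N.J => N.trials q.2)
      (r := fun q => N.prob q.2) (fun q => ha q.1 q.2) hi
      (fun x => δ * N.rate j ≤ |estimate ε (toArr x) φ j - N.rate j|)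
    refine h1.trans_le ?_
    have hinj : Function.Injective
        (fun t : {t : Fin T // (t : ℕ) < m} => ((t : Fin T), j)) := fun s t h =>
      Subtype.ext (Prod.ext_iff.1 h).1
    have hcard : Fintype.card {t : Fin T // (t : ℕ) < m} = m := by
      rw [Fintype.card_subtype]
      exact Fin.card_filter_val_lt.trans (by omega)
    have h2 := hoeffding_binomial (X := fun (t : {t : Fin T // (t : ℕ) < m}) => a t j)
      (fun t => ha t j) (hi.precomp hinj) (c := m * (δ * N.rate j))
      (mul_nonneg hm0.le (mul_nonneg hδ0 (N.rate_pos j).le))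
    rw [hcard] at h2
    have hset : {ω | δ * N.rate j ≤ |estimate ε (toArr fun q => a q.1 q.2 ω) φ j - N.rate j|} =
        {ω | m * (δ * N.rate j) ≤ |∑ t : {t : Fin T // (t : ℕ) < m}, (a t j ω : ℝ) -
          m * (N.trials j * (N.prob j : ℝ))|} := by
      ext ω
      simp only [Set.mem_ofPred_eq]
      have h3 : estimate ε (toArr fun q : Fin T × Fin N.J => a q.1 q.2 ω) φ j =
          (∑ t : {t : Fin T // (t : ℕ) < m}, (a t j ω : ℝ)) / m := by
        rw [estimate, ← Finset.sum_filter]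
        congr 1
        exact (Finset.sum_subtype _ (by simp [hm]) _)
      have h4 : (∑ t : {t : Fin T // (t : ℕ) < m}, (a t j ω : ℝ)) / m - N.rate j =
          (∑ t : {t : Fin T // (t : ℕ) < m}, (a t j ω : ℝ) -
          m * (N.trials j * (N.prob j : ℝ))) / m := by
        rw [rate]
        field_simp
      rw [h3, h4, abs_div, abs_of_pos hm0, le_div_iff₀ hm0, mul_comm]
    rw [hset]
    refine h2.trans ?_
    -- The Hoeffding exponent is 2mδ²λ_j²/n_j². It is enough that m ≥ T_φ, δ²T_φ = κ log(2J/ε) and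
    -- n_j² ≤ 2κλ_j².
    have h5 : Real.log (2 * N.J / ε) ≤
        2 * (m * (δ * N.rate j)) ^ 2 / (m * (N.trials j : ℝ) ^ 2) := by
      have ht : (0 : ℝ) < N.trials j := Nat.cast_pos.2 (N.trials_pos j)
      have ht' : (N.trials j : ℝ) ≤ N.amax := by exact_mod_cast N.trials_le_amax j
      have hr := N.rateMin_pos
      have hr' := N.rateMin_le j
      rw [le_div_iff₀ (by positivity)]
      have h6 : (N.trials j : ℝ) ^ 2 ≤ κ * (2 * N.rate j ^ 2) := by
        calc (N.trials j : ℝ) ^ 2 ≤ (N.amax : ℝ) ^ 2 := by gcongr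
          _ ≤ κ * (2 * N.rateMin ^ 2) := (div_le_iff₀ (by positivity)).1 hκ
          _ ≤ _ := by gcongr
      calc Real.log (2 * N.J / ε) * (m * (N.trials j : ℝ) ^ 2)
          ≤ Real.log (2 * N.J / ε) * (m * (κ * (2 * N.rate j ^ 2))) := by gcongr
        _ = 2 * m * N.rate j ^ 2 * (κ * Real.log (2 * N.J / ε)) := by ring
        _ = 2 * m * N.rate j ^ 2 * (δ ^ 2 * N.phaseLen ε T φ) := by rw [hδ2]
        _ ≤ 2 * m * N.rate j ^ 2 * (δ ^ 2 * m) := by gcongr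
        _ = _ := by ring
    have h7 : ε / N.J = 2 * Real.exp (-Real.log (2 * N.J / ε)) := by
      rw [← Real.log_inv, Real.exp_log (by positivity), inv_div]
      field_simp
    rw [h7, neg_div]
    gcongr
  have hone : N.arrExp T (fun _ => 1) = 1 :=
    prodExp_one fun q => sum_binomialWeight _ _
  have hle : N.arrExp T (fun _ => 1) ≤ N.arrExp T (fun x =>
      (if N.Accurate ε (toArr x) φ δ then 1 else 0) + ∑ j,
        if δ * N.rate j ≤ |estimate ε (toArr x) φ j - N.rate j| then 1 else 0) := by
    refine prodExp_mono (arrWeight_nonneg N T) fun x _ => ?_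
    have hnn : ∀ j, (0 : ℝ) ≤ if δ * N.rate j ≤ |estimate ε (toArr x) φ j - N.rate j| then 1 else 0 :=
      fun j => by split_ifs <;> norm_num
    by_cases h : N.Accurate ε (toArr x) φ δ
    · rw [if_pos h]
      have := Finset.sum_nonneg fun j (_ : j ∈ Finset.univ) => hnn j
      linarith
    · rw [if_neg h, zero_add]
      obtain ⟨j, hj⟩ := not_forall.1 h
      refine le_trans ?_ (Finset.single_le_sum (fun j _ => hnn j) (Finset.mem_univ j))
      rw [if_pos (not_le.1 hj).le]
  have hadd : N.arrExp T (fun x => (if N.Accurate ε (toArr x) φ δ then 1 else 0) + ∑ j,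
        if δ * N.rate j ≤ |estimate ε (toArr x) φ j - N.rate j| then 1 else 0) =
      N.arrExp T (fun x => if N.Accurate ε (toArr x) φ δ then 1 else 0) + ∑ j, N.arrExp T
        (fun x => if δ * N.rate j ≤ |estimate ε (toArr x) φ j - N.rate j| then 1 else 0) := by
    unfold arrExp binExp
    rw [prodExp_add, prodExp_sum]
  have hsum : ∑ j, N.arrExp T
        (fun x => if δ * N.rate j ≤ |estimate ε (toArr x) φ j - N.rate j| then 1 else 0) ≤ ε := by
    refine (Finset.sum_le_sum fun j _ => hbad j).trans (le_of_eq ?_)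
    simp
    field_simp
  rw [hone, hadd] at hle
  linarith

end Accuracy

end Network

namespace Network

/-! ### Expected reward of a core slot -/

section SlotBound

variable {V : Type u} [Fintype V] {N : Network V} {T : ℕ} {ε κ : ℝ}
  {solve : (Fin N.J → ℝ) → ℝ → N.Fwd}

theorem arrExp_resample {V : Type u} {N : Network V} {T : ℕ} (U : Fin T × Fin N.J → Prop) (F : (Fin T × Fin N.J → ℕ) → ℝ) :
    N.arrExp T F = N.arrExp T fun x => N.arrExp T fun y =>
      F (fun q => if U q then x q else y q) :=
  prodExp_resample (fun _ => sum_binomialWeight _ _) U F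

theorem shrink_eq {V : Type u} {N : Network V} {T : ℕ} {ε κ : ℝ} {φ : ℕ} (hδ : N.radius ε T κ φ ≤ 1) :
    N.shrink ε T κ 1 φ = 1 - N.radius ε T κ φ := by
  rw [shrink, one_mul]
  exact max_eq_right (sub_nonneg.2 hδ)

/-- Arrivals before the phase determine the accuracy event and the forwarding variables. With these
held fixed and all other arrivals redrawn, the slot bound `le_arrExp_slotGain` applies on the event;
its probability supplies the second factor 1-ε. -/
theorem arrExp_slot_ge (hsolve : N.IsLPSolver ε solve) (hε : 0 < ε) (hε1 : ε < 1)
    (hcap : ∀ ℓ ∈ N.links, 2 * ((1 + ε) / ε) ^ 2 * Real.log (N.maxLen / ε) ≤ N.cap ℓ)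
    {t : Fin T} (ht : N.IsCore ε T t) (hδ : 4 * N.radius ε T κ (N.phaseOf ε T t) ≤ 1)
    (hacc : 1 - ε ≤ N.arrExp T (fun x => if N.Accurate ε (toArr x) (N.phaseOf ε T t)
      (N.radius ε T κ (N.phaseOf ε T t)) then 1 else 0)) :
    (1 - ε) * ((1 - ε) * ((1 - 4 * N.radius ε T κ (N.phaseOf ε T t)) *
      N.lpObj N.rate (solve N.rate 1))) ≤
    ∑ j, N.arrExp T (fun x => if N.Accurate ε (toArr x) (N.phaseOf ε T t)
        (N.radius ε T κ (N.phaseOf ε T t)) then (x (t, j) : ℝ) *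
        slotGain ε (phaseFwd ε κ 1 solve (toArr x) (N.phaseOf ε T t)) (toArr x) (t, j) else 0) := by
  set φ := N.phaseOf ε T t with hφ
  set δ := N.radius ε T κ φ with hδdef
  have hδ0 : 0 ≤ δ := N.radius_nonneg ε T κ φ
  have hδ1 : δ < 1 := by linarith
  have hφ1 : 1 ≤ φ := Nat.one_le_iff_ne_zero.2 ht.1
  have hstart : N.phaseStart ε T φ ≤ t := N.phaseStart_phaseOf_le ε T ht.1
  obtain ⟨hfeas, -⟩ := hsolve N.rate 1 (fun j => (N.rate_pos j).le) zero_le_one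
  set v := N.lpObj N.rate (solve N.rate 1) with hv
  have hv0 : 0 ≤ v := hfeas.lpObj_nonneg fun j => (N.rate_pos j).le
  obtain ⟨U, hU⟩ : ∃ U : Fin T × Fin N.J → Prop, ∀ q, U q ↔ (q.1 : ℕ) < N.phaseStart ε T φ :=
    ⟨_, fun _ => Iff.rfl⟩
  have hqU : ∀ j, ¬ U (t, j) := fun j h => absurd ((hU _).1 h) (not_lt.2 hstart)
  -- An earlier slot within `dmax` of `t` would lie in phase φ because `t` is core, contradicting
  -- that it precedes the start of φ.
  have hUfar : ∀ q', U q' → (q'.1 : ℕ) + N.dmax < t := by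
    intro q' hq'
    have hq : (q'.1 : ℕ) < N.phaseStart ε T φ := (hU q').1 hq'
    by_contra h
    have h1 := ht.2 q'.1 (by omega) (by omega)
    have h2 := (N.phaseStart_le_iff ε T hφ1 (N.phaseOf_le ε T t) q'.1).2 h1.ge
    omega
  have hest : ∀ x y : Fin T × Fin N.J → ℕ,
      estimate ε (toArr fun q => if U q then x q else y q) φ = estimate ε (toArr x) φ := by
    intro x y
    refine estimate_congr fun t' ht' => ?_
    funext j
    exact if_pos ((hU _).2 ht')
  set f : (Fin T × Fin N.J → ℕ) → N.Fwd := fun x => phaseFwd ε κ 1 solve (toArr x) φ with hf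
  have hfm : ∀ x y : Fin T × Fin N.J → ℕ, f (fun q => if U q then x q else y q) = f x := by
    intro x y
    simp only [hf, phaseFwd, hest]
  have hAm : ∀ x y : Fin T × Fin N.J → ℕ,
      N.Accurate ε (toArr fun q => if U q then x q else y q) φ δ ↔
        N.Accurate ε (toArr x) φ δ := by
    intro x y
    simp only [Accurate, hest]
  have hstep : ∀ j, N.arrExp T (fun x => if N.Accurate ε (toArr x) φ δ then
      N.weight j * N.rate j * ((1 - ε) * ∑ ℓ ∈ N.outLinks (N.src j), f x j ℓ 0) else 0) ≤
      N.arrExp T (fun x => if N.Accurate ε (toArr x) φ δ then (x (t, j) : ℝ) *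
        slotGain ε (f x) (toArr x) (t, j) else 0) := by
    intro j
    rw [arrExp_resample U (fun x => if N.Accurate ε (toArr x) φ δ then (x (t, j) : ℝ) *
        slotGain ε (f x) (toArr x) (t, j) else 0)]
    refine prodExp_mono (arrWeight_nonneg N T) fun x _ => ?_
    simp only [hAm, hfm]
    by_cases hA : N.Accurate ε (toArr x) φ δ
    · simp only [if_pos hA]
      have hfx : N.LPFeasible (estimate ε (toArr x) φ) ε (1 - δ) (f x) := by
        rw [hδdef, ← shrink_eq hδ1.le]
        exact phaseFwd_feasible hsolve _ _
      exact le_arrExp_slotGain hfx hε hcap (fun ℓ hℓ => load_le_of_close hδ1 hA hfx hℓ) x U (t, j)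
        (hqU j) hUfar
    · simp only [if_neg hA]
      exact (prodExp_const (fun q => sum_binomialWeight _ _) 0).ge
  refine le_trans ?_ (Finset.sum_le_sum fun j _ => hstep j)
  have hsum := prodExp_sum (S := fun q : Fin T × Fin N.J => Finset.range (N.trials q.2 + 1))
    (b := fun q => binomialWeight (N.trials q.2) (N.prob q.2 : ℝ)) Finset.univ
    (fun j x => if N.Accurate ε (toArr x) φ δ then
      N.weight j * N.rate j * ((1 - ε) * ∑ ℓ ∈ N.outLinks (N.src j), f x j ℓ 0) else 0)
  refine le_trans ?_ hsum.le
  have hconst := prodExp_const_mul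
    (S := fun q : Fin T × Fin N.J => Finset.range (N.trials q.2 + 1))
    (b := fun q => binomialWeight (N.trials q.2) (N.prob q.2 : ℝ))
    ((1 - ε) * ((1 - 4 * δ) * v)) (fun x => if N.Accurate ε (toArr x) φ δ then 1 else 0)
  have hnn : 0 ≤ (1 - ε) * ((1 - 4 * δ) * v) :=
    mul_nonneg (by linarith) (mul_nonneg (by linarith) hv0)
  calc (1 - ε) * ((1 - ε) * ((1 - 4 * δ) * v))
      = ((1 - ε) * ((1 - 4 * δ) * v)) * (1 - ε) := mul_comm _ _
    _ ≤ ((1 - ε) * ((1 - 4 * δ) * v)) * _ := mul_le_mul_of_nonneg_left hacc hnn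
    _ = _ := hconst.symm
    _ ≤ _ := by
      refine prodExp_mono (arrWeight_nonneg N T) fun x _ => ?_
      by_cases hA : N.Accurate ε (toArr x) φ δ
      · simp only [if_pos hA, mul_one]
        have hest0 : ∀ j, 0 ≤ estimate ε (toArr x) φ j := estimate_nonneg (toArr x) φ
        have hopt := hsolve (estimate ε (toArr x) φ) (1 - δ) hest0 (by linarith)
        have hfeq : f x = solve (estimate ε (toArr x) φ) (1 - δ) := by
          rw [hδdef, ← shrink_eq hδ1.le]
          rfl
        rw [hfeq]
        have h1 := lpObj_ge_of_close hδ0 hδ1 hA hopt.1 hfeas hopt.2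
        refine (mul_le_mul_of_nonneg_left h1 (by linarith : 0 ≤ 1 - ε)).trans (le_of_eq ?_)
        rw [lpObj, Finset.mul_sum]
        exact Finset.sum_congr rfl fun j _ => by ring
      · simp only [if_neg hA, mul_zero, Finset.sum_const_zero, le_refl]

/-- The set of slots counted may depend on the arrivals, so inaccurate estimates are simply
discarded phase by phase. -/
theorem arrExp_dlpfReward_ge (hsolve : N.IsLPSolver ε solve) (hε : 0 < ε) (hε1 : ε < 1)
    (hcap : ∀ ℓ ∈ N.links, 2 * ((1 + ε) / ε) ^ 2 * Real.log (N.maxLen / ε) ≤ N.cap ℓ)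
    (hδ : ∀ φ, 1 ≤ φ → 4 * N.radius ε T κ φ ≤ 1)
    (hacc : ∀ φ, 1 ≤ φ → N.phaseStart ε T φ ≤ T → 1 - ε ≤ N.arrExp T
      (fun x => if N.Accurate ε (toArr x) φ (N.radius ε T κ φ) then 1 else 0))
    (init : (α : N.Arrivals T) → Choice α → Choice α)
    (prio : (α : N.Arrivals T) → Choice α → ℕ → Packet α → ℕ) :
    ∑ t : Fin T, (if N.IsCore ε T t then
      (1 - ε) * ((1 - ε) * ((1 - 4 * N.radius ε T κ (N.phaseOf ε T t)) *
      N.lpObj N.rate (solve N.rate 1))) else 0) ≤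
    N.arrExp T (fun x => dlpfReward ε κ 1 solve init prio (toArr x)) := by
  have h1 : N.arrExp T (fun x => ∑ q : Fin T × Fin N.J,
      (if N.IsCore ε T q.1 ∧ N.Accurate ε (toArr x) (N.phaseOf ε T q.1)
        (N.radius ε T κ (N.phaseOf ε T q.1)) then (x q : ℝ) *
      slotGain ε (phaseFwd ε κ 1 solve (toArr x) (N.phaseOf ε T q.1)) (toArr x) q else 0)) ≤
      N.arrExp T (fun x => dlpfReward ε κ 1 solve init prio (toArr x)) := by
    refine prodExp_mono (arrWeight_nonneg N T) fun x _ => ?_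
    convert sum_slotGain_le_dlpfReward (κ := κ) (ζ := 1) hsolve hε init prio (toArr x)
      (fun t => N.IsCore ε T t ∧ N.Accurate ε (toArr x) (N.phaseOf ε T t)
        (N.radius ε T κ (N.phaseOf ε T t))) fun t ht => ht.1
  refine le_trans ?_ h1
  unfold arrExp binExp
  rw [prodExp_sum, Fintype.sum_prod_type]
  refine Finset.sum_le_sum fun t _ => ?_
  by_cases ht : N.IsCore ε T t
  · simp only [ht, if_true, true_and]
    have hφ : 1 ≤ N.phaseOf ε T t := Nat.one_le_iff_ne_zero.2 ht.1
    exact arrExp_slot_ge hsolve hε hε1 hcap ht (hδ _ hφ)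
      (hacc _ hφ ((N.phaseStart_phaseOf_le ε T ht.1).trans t.2.le))
  · simp only [ht, if_false, false_and]
    exact (Finset.sum_eq_zero fun j _ => prodExp_const (fun q => sum_binomialWeight _ _) 0).ge

end SlotBound

end Network

namespace Network

/-! ### Upper bound for the benchmark by the LP -/

section Benchmark

variable {V : Type u} [Fintype V] {N : Network V} {T : ℕ}

/-- Schedules are binary on a finite index set, so the supremum is over a finite set. -/
theorem exists_optRI_eq (α : N.Arrivals T) :
    ∃ y : (i : Packet α) → N.Route i.type → ℕ, IsSchedule α y ∧
      optRI α = ∑ i, N.weight i.type * ∑ k, (y i k : ℝ) := by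
  set A := {v | ∃ y : (i : Packet α) → N.Route i.type → ℕ,
    IsSchedule α y ∧ v = ∑ i, N.weight i.type * ∑ k, (y i k : ℝ)} with hA
  have hne : A.Nonempty := by
    refine ⟨_, fun _ _ => 0, ⟨fun _ _ => Or.inl rfl, fun i => by simp, fun ℓ _ s _ => ?_⟩, rfl⟩
    simp
  have hfin : A.Finite := by
    let g : ((i : Packet α) → N.Route i.type → Fin 2) → ℝ :=
      fun z => ∑ i, N.weight i.type * ∑ k, ((z i k : ℕ) : ℝ)
    refine (Set.finite_range g).subset ?_
    rintro v ⟨y, hy, rfl⟩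
    refine ⟨fun i k => ⟨y i k, by rcases hy.binary i k with h | h <;> omega⟩, rfl⟩
  obtain ⟨y, hy, h⟩ := hne.csSup_mem hfin
  exact ⟨y, hy, h⟩

/-- The indicator of `w` using the link `ℓ` at age `τ`. -/
def Walk.ind {V : Type u} {N : Network V} {j : Fin N.J} (w : N.Walk j) (ℓ : V × V) (τ : ℕ) : ℝ :=
  if w.UsesAt 0 τ ℓ then 1 else 0

theorem Walk.ind_nonneg {V : Type u} {N : Network V} {j : Fin N.J} (w : N.Walk j) (ℓ : V × V)
    (τ : ℕ) : 0 ≤ w.ind ℓ τ := by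
  unfold Walk.ind
  split_ifs <;> norm_num

theorem Walk.usesAt_val {V : Type u} {N : Network V} {j : Fin N.J} (w : N.Walk j) (ℓ : V × V)
    (τ : Fin (N.deadline j + 1)) : w.UsesAt 0 τ ℓ ↔ w.edge τ = ℓ := by
  constructor
  · rintro ⟨τ', h, rfl⟩
    congr 1
    ext
    omega
  · exact fun h => ⟨τ, by omega, h⟩

theorem Walk.ind_val {V : Type u} {N : Network V} {j : Fin N.J} (w : N.Walk j) (ℓ : V × V)
    (τ : Fin (N.deadline j + 1)) : w.ind ℓ τ = if w.edge τ = ℓ then 1 else 0 := by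
  simp only [Walk.ind, w.usesAt_val]

theorem Walk.sum_ind_start {j : Fin N.J} (w : N.Walk j) :
    ∑ ℓ ∈ N.outLinks (N.src j), w.ind ℓ 0 = 1 := by
  have h : ∀ ℓ, w.ind ℓ 0 = if w.edge 0 = ℓ then 1 else 0 := fun ℓ => w.ind_val ℓ 0
  simp only [h]
  rw [Finset.sum_ite_eq, if_pos]
  exact Finset.mem_filter.2 ⟨Finset.mem_univ _, w.edge_ext 0, w.start⟩

theorem Walk.sum_ind_conserve {j : Fin N.J} (w : N.Walk j) (v : V) {τ : ℕ}
    (hτ : τ < N.deadline j) :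
    ∑ ℓ ∈ N.inLinks v, w.ind ℓ τ = ∑ ℓ ∈ N.outLinks v, w.ind ℓ (τ + 1) := by
  have h1 : ∀ ℓ, w.ind ℓ τ = _ := fun ℓ => w.ind_val ℓ (Fin.castSucc ⟨τ, hτ⟩)
  have h2 : ∀ ℓ, w.ind ℓ (τ + 1) = _ := fun ℓ => w.ind_val ℓ (Fin.succ ⟨τ, hτ⟩)
  simp only [h1, h2]
  rw [Finset.sum_ite_eq, Finset.sum_ite_eq]
  simp only [inLinks, outLinks, Finset.mem_filter, Finset.mem_univ, true_and, w.edge_ext,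
    w.chain]

theorem Walk.ind_start_eq_zero {j : Fin N.J} (w : N.Walk j) {ℓ : V × V}
    (h : ℓ ∉ N.outLinks (N.src j)) : w.ind ℓ 0 = 0 := by
  refine (w.ind_val ℓ 0).trans (if_neg ?_)
  rintro rfl
  exact h (Finset.mem_filter.2 ⟨Finset.mem_univ _, w.edge_ext 0, w.start⟩)

theorem Walk.ind_finish_eq_zero {j : Fin N.J} (w : N.Walk j) (hw : w.Arrives) {ℓ : V × V}
    (h : ℓ ∉ N.inLinks (N.dst j)) : w.ind ℓ (N.deadline j) = 0 := by
  refine (w.ind_val ℓ (Fin.last _)).trans (if_neg ?_)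
  rintro rfl
  exact h (Finset.mem_filter.2 ⟨Finset.mem_univ _, w.edge_ext _, hw⟩)

theorem Walk.sum_ind_le {V : Type u} {N : Network V} {j : Fin N.J} (w : N.Walk j) (ℓ : V × V)
    {t T : ℕ} (ht : t < T) :
    ∑ τ ∈ Finset.range (N.deadline j + 1), w.ind ℓ τ ≤
      ∑ s ∈ Finset.range (T + N.dmax), if w.UsesAt t s ℓ then (1 : ℝ) else 0 := by
  have hd := N.deadline_le_dmax j
  have h1 : ∀ τ, w.ind ℓ τ = if w.UsesAt t (t + τ) ℓ then 1 else 0 := by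
    intro τ
    simp only [Walk.ind, Walk.UsesAt, zero_add, Nat.add_left_cancel_iff]
  simp only [h1]
  refine (Finset.sum_image (f := fun s => if w.UsesAt t s ℓ then (1 : ℝ) else 0)
    (g := fun τ => t + τ) fun a _ b _ h => Nat.add_left_cancel h).symm.trans_le
    (Finset.sum_le_sum_of_subset_of_nonneg ?_ ?_)
  · intro s hs
    simp only [Finset.mem_image, Finset.mem_range] at hs ⊢
    obtain ⟨τ, hτ, rfl⟩ := hs
    omega
  · intro s _ _
    split_ifs <;> norm_num

/-- The number of type-`j` packets that use `ℓ` at age `τ` in the schedule `y`. -/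
def linkUse {α : N.Arrivals T} (y : (i : Packet α) → N.Route i.type → ℕ) (j : Fin N.J)
    (ℓ : V × V) (τ : ℕ) : ℝ :=
  ∑ i : Packet α, if i.type = j then ∑ k, (y i k : ℝ) * k.1.ind ℓ τ else 0

/-- The number of type-`j` packets scheduled by `y`. -/
def served {α : N.Arrivals T} (y : (i : Packet α) → N.Route i.type → ℕ) (j : Fin N.J) : ℝ :=
  ∑ i : Packet α, if i.type = j then ∑ k, (y i k : ℝ) else 0

theorem sum_linkUse {α : N.Arrivals T} (y : (i : Packet α) → N.Route i.type → ℕ) (j : Fin N.J)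
    (s : Finset (V × V)) (τ : ℕ) : ∑ ℓ ∈ s, linkUse y j ℓ τ =
      ∑ i : Packet α, if i.type = j then ∑ k, (y i k : ℝ) * ∑ ℓ ∈ s, k.1.ind ℓ τ else 0 := by
  unfold linkUse
  rw [Finset.sum_comm]
  refine Finset.sum_congr rfl fun i _ => ?_
  split_ifs
  · rw [Finset.sum_comm]
    simp only [Finset.mul_sum]
  · exact Finset.sum_const_zero

theorem linkUse_nonneg {α : N.Arrivals T} (y : (i : Packet α) → N.Route i.type → ℕ)
    (j : Fin N.J) (ℓ : V × V) (τ : ℕ) : 0 ≤ linkUse y j ℓ τ :=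
  Finset.sum_nonneg fun i _ => by
    split_ifs
    · exact Finset.sum_nonneg fun k _ => mul_nonneg (Nat.cast_nonneg _) (k.1.ind_nonneg ℓ τ)
    · exact le_rfl

theorem sum_linkUse_start {α : N.Arrivals T} (y : (i : Packet α) → N.Route i.type → ℕ)
    (j : Fin N.J) : ∑ ℓ ∈ N.outLinks (N.src j), linkUse y j ℓ 0 = served y j := by
  rw [sum_linkUse, served]
  refine Finset.sum_congr rfl fun i _ => ?_
  split_ifs with h
  · subst h
    refine Finset.sum_congr rfl fun k _ => ?_
    rw [k.1.sum_ind_start, mul_one]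
  · rfl

theorem served_le {α : N.Arrivals T} {y : (i : Packet α) → N.Route i.type → ℕ}
    (hy : IsSchedule α y) (j : Fin N.J) : served y j ≤ ∑ t, (α t j : ℝ) := by
  have h1 : ∀ i : Packet α, (if i.type = j then ∑ k, (y i k : ℝ) else 0) ≤
      if i.type = j then 1 else 0 := by
    intro i
    split_ifs
    · exact_mod_cast hy.one_choice i
    · exact le_rfl
  refine (Finset.sum_le_sum fun i _ => h1 i).trans (le_of_eq ?_)
  rw [sum_packet (α := α) fun q => if q.2 = j then 1 else 0, Fintype.sum_prod_type]
  simp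

theorem sum_weight_mul_served {α : N.Arrivals T} (y : (i : Packet α) → N.Route i.type → ℕ) :
    ∑ j, N.weight j * served y j = ∑ i, N.weight i.type * ∑ k, (y i k : ℝ) := by
  simp only [served, Finset.mul_sum]
  rw [Finset.sum_comm]
  refine Finset.sum_congr rfl fun i _ => ?_
  simp only [mul_ite, mul_zero]
  rw [Finset.sum_ite_eq, if_pos (Finset.mem_univ _), Finset.mul_sum]

theorem sum_linkUse_conserve {α : N.Arrivals T} (y : (i : Packet α) → N.Route i.type → ℕ)
    (j : Fin N.J) (v : V) {τ : ℕ} (hτ : τ < N.deadline j) :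
    ∑ ℓ ∈ N.inLinks v, linkUse y j ℓ τ = ∑ ℓ ∈ N.outLinks v, linkUse y j ℓ (τ + 1) := by
  rw [sum_linkUse, sum_linkUse]
  refine Finset.sum_congr rfl fun i _ => ?_
  split_ifs with h
  · subst h
    refine Finset.sum_congr rfl fun k _ => ?_
    rw [k.1.sum_ind_conserve v hτ]
  · rfl

theorem linkUse_start_eq_zero {α : N.Arrivals T} (y : (i : Packet α) → N.Route i.type → ℕ)
    (j : Fin N.J) {ℓ : V × V} (hℓ : ℓ ∉ N.outLinks (N.src j)) : linkUse y j ℓ 0 = 0 := by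
  refine Finset.sum_eq_zero fun i _ => ?_
  split_ifs with h
  · subst h
    refine Finset.sum_eq_zero fun k _ => ?_
    rw [k.1.ind_start_eq_zero hℓ, mul_zero]
  · rfl

theorem linkUse_finish_eq_zero {α : N.Arrivals T} (y : (i : Packet α) → N.Route i.type → ℕ)
    (j : Fin N.J) {ℓ : V × V} (hℓ : ℓ ∉ N.inLinks (N.dst j)) :
    linkUse y j ℓ (N.deadline j) = 0 := by
  refine Finset.sum_eq_zero fun i _ => ?_
  split_ifs with h
  · subst h
    refine Finset.sum_eq_zero fun k _ => ?_
    rw [k.1.ind_finish_eq_zero k.2 hℓ, mul_zero]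
  · rfl

/-- Uses counted by age are regrouped by absolute slot. Packets live for up to `dmax` slots past the
horizon, hence T + d_max slots, each with at most `cap` uses. -/
theorem total_linkUse_le {α : N.Arrivals T} {y : (i : Packet α) → N.Route i.type → ℕ}
    (hy : IsSchedule α y) {ℓ : V × V} (hℓ : ℓ ∈ N.links) :
    ∑ j, ∑ τ ∈ Finset.range (N.deadline j + 1), linkUse y j ℓ τ ≤ (T + N.dmax) * N.cap ℓ := by
  have h1 : ∑ j, ∑ τ ∈ Finset.range (N.deadline j + 1), linkUse y j ℓ τ =
      ∑ i : Packet α, ∑ k, (y i k : ℝ) * ∑ τ ∈ Finset.range (N.deadline i.type + 1),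
        k.1.ind ℓ τ := by
    have h2 : ∀ j, ∑ τ ∈ Finset.range (N.deadline j + 1), linkUse y j ℓ τ =
        ∑ i : Packet α, if i.type = j then ∑ k, (y i k : ℝ) *
          ∑ τ ∈ Finset.range (N.deadline j + 1), k.1.ind ℓ τ else 0 := by
      intro j
      unfold linkUse
      rw [Finset.sum_comm]
      refine Finset.sum_congr rfl fun i _ => ?_
      split_ifs
      · rw [Finset.sum_comm]
        simp only [Finset.mul_sum]
      · exact Finset.sum_const_zero
    simp only [h2]
    rw [Finset.sum_comm]
    refine Finset.sum_congr rfl fun i _ => ?_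
    rw [Finset.sum_ite_eq, if_pos (Finset.mem_univ _)]
  have h3 : ∑ i : Packet α, ∑ k, (y i k : ℝ) * ∑ τ ∈ Finset.range (N.deadline i.type + 1),
        k.1.ind ℓ τ ≤ ∑ i : Packet α, ∑ k : N.Route i.type, (y i k : ℝ) *
        ∑ s ∈ Finset.range (T + N.dmax), if k.1.UsesAt i.slot s ℓ then (1 : ℝ) else 0 :=
    Finset.sum_le_sum fun i _ => Finset.sum_le_sum fun k _ =>
      mul_le_mul_of_nonneg_left (k.1.sum_ind_le ℓ i.1.1.2) (Nat.cast_nonneg _)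
  have h4 : ∑ i : Packet α, ∑ k : N.Route i.type, (y i k : ℝ) *
        ∑ s ∈ Finset.range (T + N.dmax), (if k.1.UsesAt i.slot s ℓ then (1 : ℝ) else 0) =
      ∑ s ∈ Finset.range (T + N.dmax),
        ((∑ i, ∑ k, if k.1.UsesAt i.slot s ℓ then y i k else 0 : ℕ) : ℝ) := by
    simp only [Finset.mul_sum, mul_ite, mul_one, mul_zero]
    push_cast
    rw [Finset.sum_comm]
    refine Finset.sum_congr rfl fun i _ => ?_
    rw [Finset.sum_comm]
  rw [h1]
  refine h3.trans ?_
  rw [h4]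
  refine (Finset.sum_le_sum fun s hs => Nat.cast_le.2
    (hy.capacity ℓ hℓ s (Finset.mem_range.1 hs))).trans (le_of_eq ?_)
  simp

/-- The expected link uses of optimal schedules, suitably normalized, form a feasible point of the
LP, because all its constraints are linear. -/
theorem arrExp_optRI_le {ε : ℝ} {solve : (Fin N.J → ℝ) → ℝ → N.Fwd}
    (hsolve : N.IsLPSolver ε solve) (hε : 0 < ε) (hT : 0 < T) :
    N.arrExp T (fun x => optRI (toArr x)) ≤
      (1 + ε) * (T + N.dmax) * N.lpObj N.rate (solve N.rate 1) := by
  choose y hy hopt using fun x : Fin T × Fin N.J → ℕ => exists_optRI_eq (toArr x)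
  set c : ℝ := (1 + ε) * (T + N.dmax) with hc
  have hT' : (0 : ℝ) < T := Nat.cast_pos.2 hT
  have hd0 : (0 : ℝ) ≤ N.dmax := Nat.cast_nonneg _
  have hc0 : 0 < c := by positivity
  set E := N.arrExp T with hE
  have hEsum : ∀ {ι : Type u} (s : Finset ι) (F : ι → (Fin T × Fin N.J → ℕ) → ℝ),
      E (fun x => ∑ i ∈ s, F i x) = ∑ i ∈ s, E (F i) := fun s F => prodExp_sum s F
  have hEsum' : ∀ {ι : Type} (s : Finset ι) (F : ι → (Fin T × Fin N.J → ℕ) → ℝ),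
      E (fun x => ∑ i ∈ s, F i x) = ∑ i ∈ s, E (F i) := fun s F => prodExp_sum s F
  have hEconst : ∀ a, E (fun _ => a) = a := prodExp_const fun q => sum_binomialWeight _ _
  have hEmono : ∀ {F G : (Fin T × Fin N.J → ℕ) → ℝ}, (∀ x, F x ≤ G x) → E F ≤ E G :=
    fun h => prodExp_mono (arrWeight_nonneg N T) fun x _ => h x
  have hrate := N.rate_pos
  -- Division by `c` makes the capacity bound exactly C/(1+ε); division by the rate turns packet
  -- counts into probabilities. The choice constraint holds because at most Tλ_j ≤ cλ_j packets of
  -- type j are served on average.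
  set f : N.Fwd := fun j ℓ τ => (c * N.rate j)⁻¹ * E (fun x => linkUse (y x) j ℓ τ) with hf
  have hfsum : ∀ j (s : Finset (V × V)) τ, ∑ ℓ ∈ s, f j ℓ τ =
      (c * N.rate j)⁻¹ * E (fun x => ∑ ℓ ∈ s, linkUse (y x) j ℓ τ) := by
    intro j s τ
    rw [hEsum, Finset.mul_sum]
  have hinv : ∀ j, 0 ≤ (c * N.rate j)⁻¹ := fun j =>
    inv_nonneg.2 (mul_nonneg hc0.le (hrate j).le)
  have hserved : ∀ j, E (fun x => served (y x) j) ≤ T * N.rate j := by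
    intro j
    refine (hEmono fun x => served_le (hy x) j).trans (le_of_eq ?_)
    rw [hEsum']
    have h1 : ∀ t : Fin T, E (fun x => (x (t, j) : ℝ)) = N.rate j := fun t =>
      arrExp_apply N T (t, j)
    simp [h1]
  have hfeas : N.LPFeasible N.rate ε 1 f := by
    refine ⟨fun j ℓ τ _ _ => ?_, fun j => ?_, fun j v τ hτ => ?_, fun j ℓ _ hℓ => ?_,
      fun j ℓ _ hℓ => ?_, fun ℓ hℓ => ?_⟩
    · exact mul_nonneg (hinv j) (prodExp_nonneg (arrWeight_nonneg N T)
        fun x _ => linkUse_nonneg _ _ _ _)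
    · rw [hfsum]
      simp only [sum_linkUse_start]
      rw [inv_mul_le_iff₀ (mul_pos hc0 (hrate j)), mul_one]
      refine (hserved j).trans (mul_le_mul_of_nonneg_right ?_ (hrate j).le)
      rw [hc]
      nlinarith
    · rw [hfsum, hfsum]
      simp only [sum_linkUse_conserve _ j v hτ]
    · simp only [hf, linkUse_start_eq_zero _ j hℓ, hEconst, mul_zero]
    · simp only [hf, linkUse_finish_eq_zero _ j hℓ, hEconst, mul_zero]
    · have h1 : ∑ j, ∑ τ ∈ Finset.range (N.deadline j + 1), N.rate j * f j ℓ τ =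
          c⁻¹ * E (fun x => ∑ j, ∑ τ ∈ Finset.range (N.deadline j + 1),
            linkUse (y x) j ℓ τ) := by
        rw [hEsum', Finset.mul_sum]
        refine Finset.sum_congr rfl fun j _ => ?_
        rw [hEsum', Finset.mul_sum]
        refine Finset.sum_congr rfl fun τ _ => ?_
        have := (hrate j).ne'
        simp only [hf]
        field_simp
      have h2 : E (fun x => ∑ j, ∑ τ ∈ Finset.range (N.deadline j + 1),
            linkUse (y x) j ℓ τ) ≤ (T + N.dmax) * N.cap ℓ :=
        (hEmono fun x => total_linkUse_le (hy x) hℓ).trans (hEconst _).le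
      rw [h1, inv_mul_le_iff₀ hc0, hc]
      refine h2.trans (le_of_eq ?_)
      field_simp
  have hobj := (hsolve N.rate 1 (fun j => (hrate j).le) zero_le_one).2 f hfeas
  have hval : N.lpObj N.rate f = c⁻¹ * E (fun x => optRI (toArr x)) := by
    simp only [hopt, ← sum_weight_mul_served]
    rw [hEsum', lpObj, Finset.mul_sum]
    refine Finset.sum_congr rfl fun j _ => ?_
    rw [hfsum]
    simp only [sum_linkUse_start]
    have h1 : E (fun x => N.weight j * served (y x) j) =
      N.weight j * E (fun x => served (y x) j) := prodExp_const_mul _ _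
    rw [h1]
    have := (hrate j).ne'
    field_simp
  rw [hval, inv_mul_le_iff₀ hc0] at hobj
  exact hobj

theorem optRI_nonneg (α : N.Arrivals T) : 0 ≤ optRI α := by
  obtain ⟨y, _, h⟩ := exists_optRI_eq α
  rw [h]
  exact Finset.sum_nonneg fun i _ => mul_nonneg (N.weight_nonneg _)
    (Finset.sum_nonneg fun k _ => Nat.cast_nonneg _)

end Benchmark

end Network

/-! ### Summing over slots: boundary slots, radii and constants -/

theorem sum_sqrt_mul_two_pow_le {c : ℝ} (n : ℕ) :
    ∑ i ∈ Finset.range n, √(c * 2 ^ i) ≤ 4 * √(c * 2 ^ n) := by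
  induction n with
  | zero => simp
  | succ n ih =>
    rw [Finset.sum_range_succ, pow_succ, ← mul_assoc, Real.sqrt_mul' _ zero_le_two]
    have h1 := Real.sqrt_nonneg (c * 2 ^ n)
    -- The induction step needs 4 + 1 ≤ 4√2.
    have h2 : (5 / 4 : ℝ) ≤ √2 := Real.le_sqrt_of_sq_le (by norm_num)
    nlinarith

namespace Network

section Counting

variable {V : Type u} (N : Network V) (ε : ℝ) (T : ℕ)

/-- A later-phase slot fails to be core only if a slot within `dmax` of it has another phase, and
then a phase start lies between the two. -/
theorem exists_phaseStart_near {t : ℕ} (h0 : 1 ≤ numPhases ε) (ht : ¬ N.IsCore ε T t) :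
    t < N.len0 ε T ∨ ∃ φ ∈ Finset.Icc 1 (numPhases ε),
      N.phaseStart ε T φ ≤ t + N.dmax ∧ t < N.phaseStart ε T φ + N.dmax := by
  by_cases hp : N.phaseOf ε T t = 0
  · left
    by_contra h
    have h1 := (N.phaseStart_le_iff ε T le_rfl h0 t).1 (by simpa [phaseStart] using h)
    omega
  · right
    rw [IsCore, not_and] at ht
    have h2 := ht hp
    push Not at h2
    obtain ⟨t', h3, h4, h5⟩ := h2
    rcases lt_or_gt_of_ne h5 with h6 | h6
    · refine ⟨N.phaseOf ε T t, Finset.mem_Icc.2 ⟨by omega, N.phaseOf_le ε T t⟩, ?_⟩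
      have h7 := N.phaseStart_phaseOf_le ε T hp
      have h8 : ¬ N.phaseStart ε T (N.phaseOf ε T t) ≤ t' := fun h =>
        absurd ((N.phaseStart_le_iff ε T (by omega) (N.phaseOf_le ε T t) t').1 h) (not_le.2 h6)
      omega
    · refine ⟨N.phaseOf ε T t', Finset.mem_Icc.2 ⟨by omega, N.phaseOf_le ε T t'⟩, ?_⟩
      have h7 := N.phaseStart_phaseOf_le ε T (t := t') (by omega)
      have h8 : ¬ N.phaseStart ε T (N.phaseOf ε T t') ≤ t := fun h =>
        absurd ((N.phaseStart_le_iff ε T (by omega) (N.phaseOf_le ε T t') t).1 h) (not_le.2 h6)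
      omega

theorem card_not_core_le (h0 : 1 ≤ numPhases ε) :
    ((Finset.range T).filter fun t => ¬ N.IsCore ε T t).card ≤
      N.len0 ε T + 2 * (N.dmax * numPhases ε) := by
  have hsub : ((Finset.range T).filter fun t => ¬ N.IsCore ε T t) ⊆
      Finset.range (N.len0 ε T) ∪ (Finset.Icc 1 (numPhases ε)).biUnion fun φ =>
        Finset.Ico (N.phaseStart ε T φ - N.dmax) (N.phaseStart ε T φ + N.dmax) := by
    intro t ht
    rw [Finset.mem_filter] at ht
    rw [Finset.mem_union, Finset.mem_biUnion, Finset.mem_range]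
    refine (N.exists_phaseStart_near ε T h0 ht.2).imp_right ?_
    rintro ⟨φ, hφ, h1, h2⟩
    exact ⟨φ, hφ, Finset.mem_Ico.2 ⟨by omega, h2⟩⟩
  refine (Finset.card_le_card hsub).trans ((Finset.card_union_le _ _).trans ?_)
  rw [Finset.card_range]
  refine Nat.add_le_add_left (Finset.card_biUnion_le.trans ?_) _
  refine (Finset.sum_le_card_nsmul _ _ (2 * N.dmax) fun φ _ => ?_).trans (le_of_eq ?_)
  · rw [Nat.card_Ico]
    omega
  · simp
    ring

theorem card_phaseOf_le {i : ℕ} (hi : i + 1 < numPhases ε) :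
    ((Finset.range T).filter fun t => N.phaseOf ε T t = i + 1).card ≤
      N.dmax + N.phaseLen ε T (i + 1) := by
  have hsub : ((Finset.range T).filter fun t => N.phaseOf ε T t = i + 1) ⊆
      Finset.Ico (N.phaseStart ε T (i + 1)) (N.phaseStart ε T (i + 1 + 1)) := by
    intro t ht
    rw [Finset.mem_filter] at ht
    rw [Finset.mem_Ico]
    refine ⟨(N.phaseStart_le_iff ε T (by omega) (by omega) t).2 ht.2.ge, ?_⟩
    by_contra h
    have := (N.phaseStart_le_iff ε T (φ := i + 1 + 1) (by omega) (by omega) t).1 (not_lt.1 h)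
    omega
  refine (Finset.card_le_card hsub).trans ?_
  rw [Nat.card_Ico, N.phaseStart_succ ε T (by omega)]
  omega

/-- Since d_max ≤ T_0, each phase but the last has at most 2T_φ slots with radius √(A/T_φ),
contributing 2√(A·T_φ): a geometric sum. The last phase may be extended by rounding, so its length
is bounded by T. -/
theorem sum_radius_le (κ : ℝ) {A B : ℝ} (hA : κ * Real.log (2 * N.J / ε) = A) (hA0 : 0 ≤ A)
    (h0 : 1 ≤ numPhases ε) (hlen : 0 < N.len0 ε T) (hd : N.dmax ≤ N.len0 ε T)
    (hB : N.len0 ε T * (2 : ℝ) ^ (numPhases ε - 1) ≤ B)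
    {C : ℝ} (hC0 : 0 < C) (hC : C ≤ N.len0 ε T * (2 : ℝ) ^ (numPhases ε - 1)) :
    ∑ t ∈ (Finset.range T).filter (fun t => N.IsCore ε T t), N.radius ε T κ (N.phaseOf ε T t) ≤
      8 * √(A * B) + T * √(A / C) := by
  obtain ⟨m, hm⟩ : ∃ m, numPhases ε = m + 1 := ⟨numPhases ε - 1, by omega⟩
  rw [hm, Nat.add_sub_cancel] at hB hC
  have hl0 : (0 : ℝ) < N.len0 ε T := Nat.cast_pos.2 hlen
  have hrad : ∀ i, N.radius ε T κ (i + 1) = √(A / (N.len0 ε T * 2 ^ i)) := by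
    intro i
    rw [radius, hA, phaseLen, Nat.add_sub_cancel]
    push_cast
    rfl
  have hmaps : ∀ t ∈ (Finset.range T).filter (fun t => N.IsCore ε T t),
      N.phaseOf ε T t - 1 ∈ Finset.range (m + 1) := by
    intro t _
    have := N.phaseOf_le ε T t
    rw [Finset.mem_range]
    omega
  rw [← Finset.sum_fiberwise_of_maps_to hmaps, Finset.sum_range_succ]
  have hfib : ∀ i, ∑ t ∈ ((Finset.range T).filter fun t => N.IsCore ε T t) with
      N.phaseOf ε T t - 1 = i, N.radius ε T κ (N.phaseOf ε T t) ≤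
      ((Finset.range T).filter fun t => N.phaseOf ε T t = i + 1).card *
        √(A / (N.len0 ε T * 2 ^ i)) := by
    intro i
    have heq : ∀ t ∈ ((Finset.range T).filter fun t => N.IsCore ε T t).filter
        (fun t => N.phaseOf ε T t - 1 = i), N.phaseOf ε T t = i + 1 := by
      intro t ht
      simp only [Finset.mem_filter] at ht
      have := ht.1.2.1
      omega
    rw [Finset.sum_congr rfl fun t ht => by rw [heq t ht, hrad], Finset.sum_const, nsmul_eq_mul]
    refine mul_le_mul_of_nonneg_right ?_ (Real.sqrt_nonneg _)
    refine Nat.cast_le.2 (Finset.card_le_card fun t ht => ?_)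
    have h1 := heq t ht
    simp only [Finset.mem_filter] at ht ⊢
    exact ⟨ht.1.1, h1⟩
  refine add_le_add ?_ ?_
  · have h1 : ∀ i ∈ Finset.range m, ∑ t ∈ ((Finset.range T).filter fun t => N.IsCore ε T t) with
        N.phaseOf ε T t - 1 = i, N.radius ε T κ (N.phaseOf ε T t) ≤
        2 * √((A * N.len0 ε T) * 2 ^ i) := by
      intro i hi
      rw [Finset.mem_range] at hi
      refine (hfib i).trans ?_
      have hL : (0 : ℝ) < N.len0 ε T * 2 ^ i := by positivity
      have h2 : (((Finset.range T).filter fun t => N.phaseOf ε T t = i + 1).card : ℝ) ≤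
          2 * (N.len0 ε T * 2 ^ i) := by
        have h3 := N.card_phaseOf_le ε T (i := i) (by omega)
        rw [phaseLen, Nat.add_sub_cancel] at h3
        have h4 : N.len0 ε T ≤ N.len0 ε T * 2 ^ i := Nat.le_mul_of_pos_right _ (by positivity)
        have h5 : ((Finset.range T).filter fun t => N.phaseOf ε T t = i + 1).card ≤
          2 * (N.len0 ε T * 2 ^ i) := by omega
        exact_mod_cast h5
      refine (mul_le_mul_of_nonneg_right h2 (Real.sqrt_nonneg _)).trans (le_of_eq ?_)
      rw [mul_assoc 2]
      congr 1
      rw [mul_assoc A]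
      generalize (N.len0 ε T : ℝ) * 2 ^ i = L at hL
      have h6 : A * L = L ^ 2 * (A / L) := by field_simp
      rw [h6, Real.sqrt_mul (sq_nonneg L), Real.sqrt_sq hL.le]
    refine (Finset.sum_le_sum h1).trans ?_
    rw [← Finset.mul_sum]
    have h2 := sum_sqrt_mul_two_pow_le (c := A * N.len0 ε T) m
    have h3 : √(A * N.len0 ε T * 2 ^ m) ≤ √(A * B) := by
      apply Real.sqrt_le_sqrt
      rw [mul_assoc]
      exact mul_le_mul_of_nonneg_left hB hA0
    linarith
  · refine (hfib m).trans (mul_le_mul ?_ ?_ (Real.sqrt_nonneg _) (Nat.cast_nonneg _))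
    · have := Finset.card_filter_le (Finset.range T) fun t => N.phaseOf ε T t = m + 1
      rw [Finset.card_range] at this
      exact_mod_cast this
    · exact Real.sqrt_le_sqrt (div_le_div_of_nonneg_left hA0 hC0 hC)

theorem numPhases_bounds {ε : ℝ} (hε : 0 < ε) (hε1 : ε < 1 / 10) :
    1 ≤ numPhases ε ∧ 1 / ε ≤ (2 : ℝ) ^ numPhases ε ∧ (2 : ℝ) ^ (numPhases ε - 1) ≤ 1 / ε ∧
      1 ≤ Real.log (1 / ε) ∧ (numPhases ε : ℝ) ≤ 3 * Real.log (1 / ε) := by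
  have hinv : 10 < 1 / ε := by rw [lt_div_iff₀ hε]; linarith
  have hlog1 : 1 ≤ Real.log (1 / ε) := by
    rw [Real.le_log_iff_exp_le (by positivity)]
    linarith [Real.exp_one_lt_d9]
  have hlogb0 : 0 < Real.logb 2 (1 / ε) := Real.logb_pos one_lt_two (by linarith)
  have hΦ1 : 1 ≤ numPhases ε := Nat.ceil_pos.2 hlogb0
  have hΦup : (numPhases ε : ℝ) < Real.logb 2 (1 / ε) + 1 := Nat.ceil_lt_add_one hlogb0.le
  refine ⟨hΦ1, ?_, ?_, hlog1, ?_⟩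
  · have h1 := Nat.le_ceil (Real.logb 2 (1 / ε))
    rw [← Real.rpow_natCast]
    exact (Real.logb_le_iff_le_rpow one_lt_two (by positivity)).1 h1
  · have h1 : ((numPhases ε - 1 : ℕ) : ℝ) ≤ Real.logb 2 (1 / ε) := by
      rw [Nat.cast_sub hΦ1]
      push_cast
      linarith
    rw [← Real.rpow_natCast]
    exact (Real.le_logb_iff_rpow_le one_lt_two (by positivity)).1 h1
  · have h1 : Real.logb 2 (1 / ε) ≤ 2 * Real.log (1 / ε) := by
      rw [Real.logb, div_le_iff₀ (Real.log_pos one_lt_two)]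
      have := Real.log_two_gt_d9
      nlinarith
    linarith

theorem horizon_bounds {κ : ℝ} (hε : 0 < ε) (hε1 : ε < 1 / 10)
    (hT : 20000 * ((N.amax : ℝ) ^ 2 / (2 * N.rateMin ^ 2 * ε ^ 2) * Real.log (2 * N.J / ε)
          + 2 * (N.dmax : ℝ) ^ 2 * Real.log (1 / ε) / ε) ≤ T)
    (hκ : κ ≤ 2 * ((N.amax : ℝ) ^ 2 / (2 * N.rateMin ^ 2))) :
    0 ≤ Real.log (2 * N.J / ε) ∧ 10000 * (κ * Real.log (2 * N.J / ε)) ≤ ε ^ 2 * T ∧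
      10000 ≤ ε ^ 2 * T ∧ 10000 * ((N.dmax : ℝ) * numPhases ε) ≤ ε * T := by
  have hJ1 : (1 : ℝ) ≤ N.J := by exact_mod_cast N.J_pos
  obtain ⟨-, -, -, hlog1, hΦle⟩ := numPhases_bounds hε hε1
  have hlogJ : 1 ≤ Real.log (2 * N.J / ε) := by
    refine hlog1.trans (Real.log_le_log (by positivity) ?_)
    gcongr
    linarith
  -- Since λ_min ≤ a_max; with log(2J/ε) ≥ 1 this turns the horizon condition into an absolute lower
  -- bound on ε²T.
  have hR1 : 1 / 2 ≤ (N.amax : ℝ) ^ 2 / (2 * N.rateMin ^ 2) := by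
    have h1 := N.rateMin_pos
    have h2 := N.rateMin_le_amax
    rw [div_le_div_iff₀ (by norm_num) (by positivity)]
    nlinarith
  have hsplit : (N.amax : ℝ) ^ 2 / (2 * N.rateMin ^ 2 * ε ^ 2) * Real.log (2 * N.J / ε) =
      (N.amax : ℝ) ^ 2 / (2 * N.rateMin ^ 2) * Real.log (2 * N.J / ε) / ε ^ 2 := by
    have := N.rateMin_pos
    field_simp
  rw [hsplit] at hT
  generalize (N.amax : ℝ) ^ 2 / (2 * N.rateMin ^ 2) = R at *
  generalize Real.log (2 * N.J / ε) = lJ at *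
  generalize Real.log (1 / ε) = le at *
  -- `dmax` is a natural number, so the quadratic term of the horizon condition dominates the linear
  -- quantity d_max·Φ.
  have hDD : (N.dmax : ℝ) ≤ (N.dmax : ℝ) ^ 2 := by exact_mod_cast Nat.le_self_pow two_ne_zero _
  have hD0 : (0 : ℝ) ≤ N.dmax := Nat.cast_nonneg _
  generalize (N.dmax : ℝ) = D at *
  have hY0 : 0 ≤ 2 * D ^ 2 * le / ε := by positivity
  have hX0 : 0 ≤ R * lJ / ε ^ 2 := by positivity
  have hRlJ : 20000 * (R * lJ) ≤ ε ^ 2 * T := by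
    have h1 : 20000 * (R * lJ / ε ^ 2) ≤ T := by linarith
    have h2 := mul_le_mul_of_nonneg_left h1 (sq_nonneg ε)
    refine le_trans (le_of_eq ?_) h2
    field_simp
  have hDle : 40000 * (D ^ 2 * le) ≤ ε * T := by
    have h1 : 20000 * (2 * D ^ 2 * le / ε) ≤ T := by linarith
    have h2 := mul_le_mul_of_nonneg_left h1 hε.le
    refine le_trans (le_of_eq ?_) h2
    field_simp
    ring
  have h1 : 1 / 2 * 1 ≤ R * lJ := mul_le_mul hR1 hlogJ zero_le_one (by linarith)
  have h2 : κ * lJ ≤ 2 * R * lJ := mul_le_mul_of_nonneg_right hκ (by linarith)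
  have h3 : D * numPhases ε ≤ D ^ 2 * (3 * le) :=
    mul_le_mul hDD hΦle (Nat.cast_nonneg _) (sq_nonneg _)
  have h4 : 0 ≤ D ^ 2 * le := by positivity
  exact ⟨by linarith, by linarith, by linarith, by linarith⟩

theorem len0_bounds (hε : 0 < ε) (hε1 : ε < 1 / 10) (hT : 10000 ≤ ε ^ 2 * T)
    (hD : 10000 * ((N.dmax : ℝ) * numPhases ε) ≤ ε * T) :
    (N.len0 ε T : ℝ) ≤ ε * T ∧ ε * T / 2 ≤ N.len0 ε T := by
  have hT0 : (0 : ℝ) ≤ T := Nat.cast_nonneg T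
  have hεT0 : 0 ≤ ε * T := mul_nonneg hε.le hT0
  have hεTT : ε * T ≤ T := mul_le_of_le_one_left hT0 (by linarith)
  have hεT : 10000 ≤ ε * T := hT.trans (by
    rw [sq, mul_assoc]
    exact mul_le_of_le_one_left hεT0 (by linarith))
  set S : ℝ := (N.dmax : ℝ) * numPhases ε with hS
  have hS0 : 0 ≤ S := mul_nonneg (Nat.cast_nonneg _) (Nat.cast_nonneg _)
  have hεS : ε * S ≤ S := mul_le_of_le_one_left hS0 (by linarith)
  have hεS0 : 0 ≤ ε * S := mul_nonneg hε.le hS0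
  constructor
  · refine (Nat.floor_le (mul_nonneg hε.le (by linarith))).trans ?_
    rw [mul_sub]
    linarith
  · have h1 : ε * (T - S) < N.len0 ε T + 1 := Nat.lt_floor_add_one _
    rw [mul_sub] at h1
    linarith

/-- The horizon is long enough for the slots outside the core, and the confidence radii, to
cost little. -/
theorem core_sum_ge {κ : ℝ} (hε : 0 < ε) (hε1 : ε < 1 / 10)
    (hT : 20000 * ((N.amax : ℝ) ^ 2 / (2 * N.rateMin ^ 2 * ε ^ 2) * Real.log (2 * N.J / ε)
          + 2 * (N.dmax : ℝ) ^ 2 * Real.log (1 / ε) / ε) ≤ T)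
    (hκ0 : 0 ≤ κ) (hκ : κ ≤ 2 * ((N.amax : ℝ) ^ 2 / (2 * N.rateMin ^ 2))) :
    0 < T ∧ 0 < N.len0 ε T ∧ (∀ φ, 4 * N.radius ε T κ φ ≤ 1) ∧ (N.dmax : ℝ) ≤ ε * T ∧
    (1 - 3 / 2 * ε) * T ≤ ∑ t ∈ (Finset.range T).filter (fun t => N.IsCore ε T t),
      (1 - 4 * N.radius ε T κ (N.phaseOf ε T t)) := by
  obtain ⟨hlog0, hAle, hε2T, hDΦ⟩ := N.horizon_bounds ε T hε hε1 hT hκ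
  obtain ⟨hΦ1, hΦlow, hΦpow, -, -⟩ := numPhases_bounds hε hε1
  obtain ⟨hlen_le, hlen_ge⟩ := N.len0_bounds ε T hε hε1 hε2T hDΦ
  have hT0 : (0 : ℝ) ≤ T := Nat.cast_nonneg T
  have hεT0 : 0 ≤ ε * T := mul_nonneg hε.le hT0
  have hε2 : ε ^ 2 * T ≤ ε * T := by
    rw [sq, mul_assoc]
    exact mul_le_of_le_one_left hεT0 (by linarith)
  have hTpos : (0 : ℝ) < T := by
    refine lt_of_le_of_ne hT0 fun h => ?_
    rw [← h] at hε2T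
    linarith
  have hDΦ1 : (N.dmax : ℝ) ≤ N.dmax * numPhases ε :=
    le_mul_of_one_le_right (Nat.cast_nonneg _) (by exact_mod_cast hΦ1)
  have hlen0 : 0 < N.len0 ε T := by
    have : (0 : ℝ) < N.len0 ε T := by linarith
    exact_mod_cast this
  have hdlen : N.dmax ≤ N.len0 ε T := by
    have : (N.dmax : ℝ) ≤ N.len0 ε T := by linarith
    exact_mod_cast this
  have hA0 : 0 ≤ κ * Real.log (2 * N.J / ε) := mul_nonneg hκ0 hlog0
  have hrad : ∀ φ, 4 * N.radius ε T κ φ ≤ 1 := by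
    intro φ
    have h1 : (N.len0 ε T : ℝ) ≤ N.phaseLen ε T φ := by
      exact_mod_cast Nat.le_mul_of_pos_right _ (by positivity)
    have h2 : 0 < (N.phaseLen ε T φ : ℝ) := by linarith
    have h3 : N.radius ε T κ φ ≤ 1 / 4 := by
      rw [radius]
      refine Real.sqrt_le_iff.2 ⟨by norm_num, ?_⟩
      rw [div_le_iff₀ h2]
      linarith
    linarith
  refine ⟨by exact_mod_cast hTpos, hlen0, hrad, by linarith, ?_⟩
  have hB : N.len0 ε T * (2 : ℝ) ^ (numPhases ε - 1) ≤ T := by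
    calc N.len0 ε T * (2 : ℝ) ^ (numPhases ε - 1) ≤ (ε * T) * (1 / ε) :=
          mul_le_mul hlen_le hΦpow (by positivity) hεT0
      _ = T := by field_simp
  have hC : (T : ℝ) / 4 ≤ N.len0 ε T * (2 : ℝ) ^ (numPhases ε - 1) := by
    have h1 : (2 : ℝ) ^ numPhases ε = 2 ^ (numPhases ε - 1) * 2 := by
      rw [← pow_succ, Nat.sub_add_cancel hΦ1]
    calc (T : ℝ) / 4 = (ε * T / 2) * (1 / ε / 2) := by field_simp; norm_num
      _ ≤ _ := mul_le_mul hlen_ge (by linarith) (by positivity) (Nat.cast_nonneg _)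
  have hsum := N.sum_radius_le ε T κ rfl hA0 hΦ1 hlen0 hdlen hB (by linarith) hC
  generalize κ * Real.log (2 * N.J / ε) = A at *
  have hs1 : √(A * T) ≤ ε * T / 100 := by
    refine Real.sqrt_le_iff.2 ⟨by linarith, ?_⟩
    have := mul_le_mul_of_nonneg_right hAle hT0
    linarith
  have hs2 : √(A / (T / 4)) ≤ ε / 50 := by
    refine Real.sqrt_le_iff.2 ⟨by linarith, ?_⟩
    rw [div_le_iff₀ (by linarith)]
    linarith
  have hs3 := mul_le_mul_of_nonneg_left hs2 hT0
  have hcard : (T : ℝ) ≤ ((Finset.range T).filter fun t => N.IsCore ε T t).card +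
      (N.len0 ε T + 2 * (N.dmax * numPhases ε)) := by
    have h1 := N.card_not_core_le ε T hΦ1
    have h2 := Finset.card_filter_add_card_filter_not (s := Finset.range T)
      (fun t => N.IsCore ε T t)
    rw [Finset.card_range] at h2
    have h3 : T ≤ ((Finset.range T).filter fun t => N.IsCore ε T t).card +
      (N.len0 ε T + 2 * (N.dmax * numPhases ε)) := by omega
    exact_mod_cast h3
  -- The losses in units of εT are at most 1 for phase 0, 2/10000 for the boundaries, and 4(8/100 +
  -- 1/50) = 0.4 for the radii: below 3/2 in total.
  rw [Finset.sum_sub_distrib, Finset.sum_const, nsmul_eq_mul, mul_one, ← Finset.mul_sum]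
  linarith

end Counting

end Network

/-! ### Assembly of the bounds -/

/-- DLPF is a `1 - 10 ε` approximation when the capacities and the horizon are large. -/
theorem Network.providesApproximation_dlpfReward {V : Type u} [Fintype V] {N : Network V} {ε : ℝ}
    {T : ℕ} {Ω : Type v} [MeasurableSpace Ω] {P : MeasureTheory.Measure Ω}
    [MeasureTheory.IsProbabilityMeasure P] {a : Fin T → Fin N.J → Ω → ℕ} {κ : ℝ}
    {solve : (Fin N.J → ℝ) → ℝ → N.Fwd}
    (init : (α : N.Arrivals T) → Network.Choice α → Network.Choice α)
    (prio : (α : N.Arrivals T) → Network.Choice α → ℕ → Network.Packet α → ℕ)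
    (hε : 0 < ε) (hε1 : ε < 1)
    (ha : ∀ t j, ProbabilityTheory.HasLaw (a t j)
      (ProbabilityTheory.binomial (N.trials j) (N.prob j)) P)
    (hi : ProbabilityTheory.iIndepFun (fun (q : Fin T × Fin N.J) => a q.1 q.2) P)
    (hcap : ∀ ℓ ∈ N.links, 2 * ((1 + ε) / ε) ^ 2 * Real.log (N.maxLen / ε) ≤ N.cap ℓ)
    (hT : 20000 * ((N.amax : ℝ) ^ 2 / (2 * N.rateMin ^ 2 * ε ^ 2) * Real.log (2 * N.J / ε)
      + 2 * (N.dmax : ℝ) ^ 2 * Real.log (1 / ε) / ε) ≤ T)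
    (hκ : κ = (N.amax : ℝ) ^ 2 / (2 * N.rateMin ^ 2) ∨
      (κ = 1 / N.rateMin ∧ (N.amax : ℝ) ^ 2 ≤ 2 * N.rateMin))
    (hsolve : N.IsLPSolver ε solve) :
    ProvidesApproximation P a (1 - 10 * ε) (Network.dlpfReward ε κ 1 solve init prio) := by
  unfold ProvidesApproximation
  -- For ε ≥ 1/10 the factor 1-10ε is not positive, and both expectations are nonnegative.
  rcases le_or_gt (1 / 10) ε with hbig | hsmall
  · have h1 : 0 ≤ ∫ ω, Network.optRI (N := N) (fun t j => a t j ω) ∂P :=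
      MeasureTheory.integral_nonneg fun ω => Network.optRI_nonneg _
    have h2 : 0 ≤ ∫ ω, Network.dlpfReward ε κ 1 solve init prio (fun t j => a t j ω) ∂P :=
      MeasureTheory.integral_nonneg fun ω => Network.dlpfReward_nonneg hsolve init prio _
    nlinarith
  have hopt : ∫ ω, Network.optRI (N := N) (fun t j => a t j ω) ∂P =
      N.arrExp T (fun x => Network.optRI (Network.toArr x)) :=
    integral_eq_binExp (fun q : Fin T × Fin N.J => N.trials q.2) (fun q => ha q.1 q.2) hi
      (fun x => Network.optRI (Network.toArr x))
  have halg : ∫ ω, Network.dlpfReward ε κ 1 solve init prio (fun t j => a t j ω) ∂P =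
      N.arrExp T (fun x => Network.dlpfReward ε κ 1 solve init prio (Network.toArr x)) :=
    integral_eq_binExp (fun q : Fin T × Fin N.J => N.trials q.2) (fun q => ha q.1 q.2) hi
      (fun x => Network.dlpfReward ε κ 1 solve init prio (Network.toArr x))
  rw [hopt, halg]
  have hr := N.rateMin_pos
  have hra := N.rateMin_le_amax
  have ha1 : (1 : ℝ) ≤ N.amax := by
    have h1 := N.trials_le_amax ⟨0, N.J_pos⟩
    have h2 := N.trials_pos ⟨0, N.J_pos⟩
    exact_mod_cast h2.trans_le h1
  -- For κ = 1/λ_min this bound is equivalent to a_max² ≤ 2λ_min.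
  have hκlow : (N.amax : ℝ) ^ 2 / (2 * N.rateMin ^ 2) ≤ κ := by
    rcases hκ with h | ⟨h, h'⟩
    · exact h.ge
    · rw [h, div_le_div_iff₀ (by positivity) hr]
      nlinarith
  -- For κ = 1/λ_min this amounts to λ_min ≤ a_max², true because λ_min ≤ a_max and a_max ≥ 1.
  have hκup : κ ≤ 2 * ((N.amax : ℝ) ^ 2 / (2 * N.rateMin ^ 2)) := by
    rcases hκ with h | ⟨h, -⟩
    · have h1 : 0 ≤ (N.amax : ℝ) ^ 2 / (2 * N.rateMin ^ 2) := by positivity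
      rw [h]
      linarith
    · have h1 : N.rateMin ≤ (N.amax : ℝ) ^ 2 := by nlinarith
      have h2 : 2 * ((N.amax : ℝ) ^ 2 / (2 * N.rateMin ^ 2)) =
        (N.amax : ℝ) ^ 2 / N.rateMin ^ 2 := by field_simp
      rw [h, h2, div_le_div_iff₀ hr (by positivity)]
      nlinarith
  have hκ0 : 0 ≤ κ := le_trans (by positivity) hκlow
  obtain ⟨hTpos, hlen, hrad, hD, hcore⟩ := N.core_sum_ge ε T hε hsmall hT hκ0 hκup
  have hup := Network.arrExp_optRI_le hsolve hε hTpos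
  have hlow := Network.arrExp_dlpfReward_ge hsolve hε hε1 hcap (fun φ _ => hrad φ)
    (fun φ hφ hφT => Network.arrExp_accurate_ge ha hi hε hε1 hκlow hφ
      (Nat.mul_pos hlen (by positivity)) hφT) init prio
  have hv : 0 ≤ N.lpObj N.rate (solve N.rate 1) :=
    (hsolve N.rate 1 (fun j => (N.rate_pos j).le) zero_le_one).1.lpObj_nonneg
      fun j => (N.rate_pos j).le
  set v := N.lpObj N.rate (solve N.rate 1)
  have hsum : ∑ t : Fin T, (if N.IsCore ε T t then
      (1 - ε) * ((1 - ε) * ((1 - 4 * N.radius ε T κ (N.phaseOf ε T t)) * v)) else 0) =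
      ((1 - ε) * (1 - ε) * v) * ∑ t ∈ (Finset.range T).filter (fun t => N.IsCore ε T t),
      (1 - 4 * N.radius ε T κ (N.phaseOf ε T t)) := by
    rw [Fin.sum_univ_eq_sum_range (fun t => if N.IsCore ε T t then
      (1 - ε) * ((1 - ε) * ((1 - 4 * N.radius ε T κ (N.phaseOf ε T t)) * v)) else 0) T,
      ← Finset.sum_filter, Finset.mul_sum]
    exact Finset.sum_congr rfl fun t _ => by ring
  rw [hsum] at hlow
  have hTnn : (0 : ℝ) ≤ T := Nat.cast_nonneg T
  have hTv : 0 ≤ (T : ℝ) * v := mul_nonneg hTnn hv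
  rcases le_or_gt (1 - 10 * ε) 0 with hneg | hpos
  · linarith
  calc (1 - 10 * ε) * N.arrExp T (fun x => Network.optRI (Network.toArr x))
      ≤ (1 - 10 * ε) * ((1 + ε) * (T + N.dmax) * v) := mul_le_mul_of_nonneg_left hup hpos.le
    _ ≤ (1 - 10 * ε) * ((1 + ε) * (T + ε * T) * v) := by gcongr
    _ = ((1 - 10 * ε) * (1 + ε) ^ 2) * (T * v) := by ring
    _ ≤ ((1 - ε) ^ 2 * (1 - 3 / 2 * ε)) * (T * v) := by
        refine mul_le_mul_of_nonneg_right ?_ hTv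
        nlinarith [mul_pos hε hε, mul_pos (mul_pos hε hε) hε]
    _ = ((1 - ε) * (1 - ε) * v) * ((1 - 3 / 2 * ε) * T) := by ring
    _ ≤ _ := mul_le_mul_of_nonneg_left hcore
        (mul_nonneg (mul_nonneg (by linarith) (by linarith)) hv)
    _ ≤ _ := hlow

end

theorem theorem2 :
    ∃ K : ℝ, 0 < K ∧
      ∀ (V : Type u) [Fintype V] (N : Network V) (ε : ℝ) (T : ℕ)
        (Ω : Type v) [MeasurableSpace Ω] (P : MeasureTheory.Measure Ω)
        [MeasureTheory.IsProbabilityMeasure P] (a : Fin T → Fin N.J → Ω → ℕ)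
        (κ : ℝ) (solve : (Fin N.J → ℝ) → ℝ → N.Fwd)
        (init : (α : N.Arrivals T) → Network.Choice α → Network.Choice α)
        (prio : (α : N.Arrivals T) → Network.Choice α → ℕ → Network.Packet α → ℕ),
        0 < ε → ε < 1 →
        (∀ t j, ProbabilityTheory.HasLaw (a t j)
          (ProbabilityTheory.binomial (N.trials j) (N.prob j)) P) →
        ProbabilityTheory.iIndepFun (fun (q : Fin T × Fin N.J) => a q.1 q.2) P →
        (∀ ℓ ∈ N.links, 2 * ((1 + ε) / ε) ^ 2 * Real.log (N.maxLen / ε) ≤ N.cap ℓ) →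
        K * ((N.amax : ℝ) ^ 2 / (2 * N.rateMin ^ 2 * ε ^ 2) * Real.log (2 * N.J / ε)
          + 2 * (N.dmax : ℝ) ^ 2 * Real.log (1 / ε) / ε) ≤ T →
        (κ = (N.amax : ℝ) ^ 2 / (2 * N.rateMin ^ 2) ∨
          (κ = 1 / N.rateMin ∧ (N.amax : ℝ) ^ 2 ≤ 2 * N.rateMin)) →
        N.IsLPSolver ε solve →
        (∀ α r s, Function.Injective (prio α r s)) →
        ProvidesApproximation P a (1 - 10 * ε)
          (Network.dlpfReward ε κ 1 solve init prio) := by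
  refine ⟨20000, by norm_num, ?_⟩
  intro V _ N ε T Ω _ P _ a κ solve init prio hε hε1 ha hi hcap hT hκ hsolve _
  exact Network.providesApproximation_dlpfReward init prio hε hε1 ha hi hcap hT hκ hsolve
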